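/- Let $n\ge 1$ be an integer, let $\mathbb B^n$ be the open unit ball of $\mathbb C^n$ with $\langle z,w\rangle=\sum_k z_k\overline{w_k}$ and $|z|=\sqrt{\langle z,z\rangle}$, and let $v$ be Lebesgue measure. For $\alpha>-1$ put $c_\alpha=\dfrac{\Gamma(\alpha+n+1)}{\Gamma(\alpha+1)\pi^n}$ and, for $f\in L^\infty(\mathbb B^n)$ real-valued, $$(B_\alpha f)(z)=c_\alpha\int_{\mathbb B^n}\frac{(1-|z|^2)^{n+1}}{|1-\langle z,w\rangle|^{2n+2}}\,f(w)\,(1-|w|^2)^\alpha\,dv(w),\qquad z\in\mathbb B^n .$$ For real-valued $u\in C^1(\mathbb B^n)$ let $\nabla u=\left(\frac{\partial u}{\partial x_1},\frac{\partial u}{\partial y_1},\dots,\frac{\partial u}{\partial x_n},\frac{\partial u}{\partial y_n}\right)$, where $z_k=x_k+iy_k$, be the real gradient, $\|u\|_*=\sup_{|z|<1}(1-|z|^2)|\nabla u(z)|\in[0,+\infty]$, and let $\|B_\alpha\|_*=\sup\|B_\alpha f\|_*$, the supremum being over all real-valued $f$ with $\|f\|_\infty\le 1$. Then $B_\alpha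 f\in C^1(\mathbb B^n)$ for all real-valued $f\in L^\infty(\mathbb B^n)$ and all $\alpha>-1$, and the following holds. (i) If $0\le\alpha\le n+\frac12$, then $$\|B_\alpha\|_*=2c_\alpha(n+1)\int_{\mathbb B^n}|\operatorname{Re}\zeta_1|\,(1-|\zeta|^2)^\alpha\,dv(\zeta)=\frac2\pi\,(n+1)\,B\!\left(\alpha+n+1,\tfrac12\right),$$ where $B(\cdot,\cdot)$ is Euler's Beta function. Call $f$ extremal if $f(w)=\dfrac{|\operatorname{Re}\langle w,a\rangle|}{\operatorname{Re}\langle w,a\rangle}$ for almost every $w\in\mathbb B^n$, for some $a\in\mathbb C^n$ with $|a|=1$. For real-valued $f$ with $\|f\|_\infty\le1$: if $f$ is extremal, then $\|B_\alpha f\|_*=\|B_\alpha\|_*$; if $\alpha>0$, then conversely $\|B_\alpha f\|_*=\|B_\alpha\|_*$ implies that $f$ is extremal; and, for $\alpha=0$ as well, the value is attained at the origin, i.e. $|\nabla(B_\alpha f)(0)|=\|B_\alpha\|_*$, if and only if $f$ is extremal. (ii) If $-1<\alpha<0$, then $\|B_\alpha\|_*=+\infty$. (iii) If $\alpha>n+\frac12$,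 then $$\|B_\alpha\|_*<\frac{2}{\sqrt\pi}\,(n+1)\binom{2k'_\alpha+2\alpha-1}{2k'_\alpha}\binom{k'_\alpha+\alpha-1}{k'_\alpha}^{-1}\frac{(k'_\alpha)!\;\Gamma(\alpha+n+1)}{\Gamma\!\left(k'_\alpha+\alpha+n+\frac32\right)},\qquad k'_\alpha=\left\lceil\frac{\alpha}{2n+1}-\frac12\right\rceil,$$ where $\lceil x\rceil$ is the smallest non-negative integer not smaller than $x$ and $\binom{x}{k}=\frac{x(x-1)\cdots(x-k+1)}{k!}$ for real $x$. -/

import Mathlib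

open MeasureTheory Set Metric
open scoped ENNReal

noncomputable section

namespace BerezinBloch

/-- The Hermitian product `⟨z, w⟩ = ∑ k, z k * conj (w k)` on `ℂⁿ`, linear in the first variable
(Mathlib's inner product is linear in the second one). -/
def herm {n : ℕ} (z w : EuclideanSpace ℂ (Fin n)) : ℂ := inner ℂ w z

theorem herm_eq_sum {n : ℕ} (z w : EuclideanSpace ℂ (Fin n)) :
    herm z w = ∑ k, z k * (starRingEnd ℂ) (w k) := rfl

/-- The open unit ball `𝔹ⁿ` of `ℂⁿ`. -/
def unitBall (n : ℕ) : Set (EuclideanSpace ℂ (Fin n)) := ball 0 1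

/-- Lebesgue measure `v` restricted to the unit ball. -/
def ballVolume (n : ℕ) : Measure (EuclideanSpace ℂ (Fin n)) := volume.restrict (unitBall n)

/-- The constant `c_α = Γ(α + n + 1) / (Γ(α + 1) πⁿ)`. -/
def normConst (n : ℕ) (α : ℝ) : ℝ :=
  Real.Gamma (α + n + 1) / (Real.Gamma (α + 1) * Real.pi ^ n)

/-- The weighted Berezin transform
`(B_α f)(z) = c_α ∫_{𝔹ⁿ} (1 - |z|²)ⁿ⁺¹ / |1 - ⟨z, w⟩|²ⁿ⁺² f(w) (1 - |w|²)^α dv(w)`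
of a real-valued function. -/
def berezin (n : ℕ) (α : ℝ) (f : EuclideanSpace ℂ (Fin n) → ℝ) (z : EuclideanSpace ℂ (Fin n)) :
    ℝ :=
  normConst n α * ∫ w, (1 - ‖z‖ ^ 2) ^ (n + 1) / ‖1 - herm z w‖ ^ (2 * n + 2) * f w
    * (1 - ‖w‖ ^ 2) ^ α ∂(ballVolume n)

/-- The seminorm `‖u‖_* = sup_{|z| < 1} (1 - |z|²) |∇u(z)|`, as an extended nonnegative real.
The gradient is the one for the real inner product `Re ⟨z, w⟩` on `ℂⁿ`, for which
`e₁, i e₁, …, eₙ, i eₙ` is an orthonormal basis, so that its coordinates are the partial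
derivatives of `u` with respect to `x₁, y₁, …, xₙ, yₙ`. -/
def blochSeminorm {n : ℕ} (u : EuclideanSpace ℂ (Fin n) → ℝ) : ℝ≥0∞ :=
  ⨆ z ∈ unitBall n, ENNReal.ofReal ((1 - ‖z‖ ^ 2) * ‖gradient u z‖)

/-- The real-valued functions in the closed unit ball of `L^∞(𝔹ⁿ)`. -/
def unitLinfty (n : ℕ) : Set (EuclideanSpace ℂ (Fin n) → ℝ) :=
  {f | MemLp f ∞ (ballVolume n) ∧ eLpNorm f ∞ (ballVolume n) ≤ 1}

/-- The operator seminorm `‖B_α‖_* = sup_{‖f‖_∞ ≤ 1} ‖B_α f‖_*`, over real-valued `f`. -/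
def opSeminorm (n : ℕ) (α : ℝ) : ℝ≥0∞ :=
  ⨆ f ∈ unitLinfty n, blochSeminorm (berezin n α f)

/-- `f(w) = |Re ⟨w, a⟩| / Re ⟨w, a⟩` for almost every `w` in the ball, for some unit vector `a`. -/
def IsExtremal {n : ℕ} (f : EuclideanSpace ℂ (Fin n) → ℝ) : Prop :=
  ∃ a : EuclideanSpace ℂ (Fin n), ‖a‖ = 1 ∧
    f =ᵐ[ballVolume n] fun w => |(herm w a).re| / (herm w a).re

/-- `k'_α = ⌈α / (2n + 1) - 1/2⌉`, the smallest natural number that is not smaller. -/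
def kPrime (n : ℕ) (α : ℝ) : ℕ := ⌈α / (2 * n + 1) - 1 / 2⌉₊

end BerezinBloch

end

/-! The substitution `w = φ_z(ζ)`, where `φ_z` is the involution of the ball exchanging `0` and `z`,
has real Jacobian `((1 - |z|²) / |1 - ⟨ζ, z⟩|²)ⁿ⁺¹`, the reciprocal of the kernel at `(z, φ_z(ζ))`,
and it turns the logarithmic gradient of the kernel into a linear function of `ζ`
(`kernel_moebius_mul`, `logGrad_moebius`). Hence, up to the factor `2 c_α (n + 1)`, the derivative
of `B_α f` at `z` in direction `h`, times `1 - |z|²`, is at most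
`(1 - |z|²)^α ∫ |Re ⟨h', ζ⟩| (1 - |ζ|²)^α |1 - ⟨ζ, z⟩|^(-2α) dv(ζ)` with `|h'| ≤ |h|`, and equality
holds for a suitable sign function `f`. This integral is called `majorant`.

For `α = 0` the majorant is largest at `|h'| = 1`, independently of `z`. For `α > 0` put
`x = Re ⟨ζ, z⟩` and use `|1 - ⟨ζ, z⟩| ≥ 1 - x`. Only the even part `∑ A_k x²ᵏ` of `(1 - x)^(-2α)`
survives the symmetry `ζ ↦ -ζ`. Its coefficients are positive, and by the inequality of arithmetic
and geometric means each integral `∫ |Re ⟨h', ζ⟩| x²ᵏ (1 - |ζ|²)^α` is at most `J_k |z|²ᵏ`, where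
`J_k = ∫ |Re ζ₁|²ᵏ⁺¹ (1 - |ζ|²)^α` is a quotient of Gamma values
(`setIntegral_abs_inner_pow_mul_weight`). So the majorant is at most the quotient of
`∑ A_k J_k |z|²ᵏ` by `∑ B_k |z|²ᵏ = (1 - |z|²)^(-α)` (`majorant_le_tsum`). The ratios
`A_k J_k / B_k` increase up to the index `k'_α` and do not increase afterwards
(`coeffRatio_succ_le_iff`), so the majorant is at most the ratio with index `k'_α`. If
`α ≤ n + 1/2`, then `k'_α = 0`, and the bound is the value at the origin for the extremal functions.
If `α > n + 1/2`, the ratio is strictly smaller at `k = 0` and, by a fixed amount, for all large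
`k`, which makes the bound strict uniformly in `z` (`exists_lt_mul_tsum_le`). The same uniform
strictness away from the origin, for `0 < α ≤ n + 1/2`, shows that the seminorm can equal the bound
only if the gradient at the origin does; there equality forces `f` to be the sign of `Re ⟨w, a⟩`
almost everywhere.

For `α < 0` the factor `(1 - |z|²)^α` is unbounded, while the remaining integral stays away from
zero. -/

noncomputable section

namespace BerezinBloch

/-! ### Moments of linear functionals over a ball -/

theorem weight_pos {E : Type*} [NormedAddCommGroup E] {x : E}
    (hx : x ∈ ball (0 : E) 1) (α : ℝ) : 0 < (1 - ‖x‖ ^ 2) ^ α := by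
  have : ‖x‖ < 1 := by simpa using hx
  exact Real.rpow_pos_of_pos (by nlinarith [norm_nonneg x]) α

section Moments

variable {E : Type*} [NormedAddCommGroup E] [InnerProductSpace ℝ E] [FiniteDimensional ℝ E]
  [MeasurableSpace E] [BorelSpace E]

/-- Polar coordinates for the product of a power of a linear functional and a radial function. -/
theorem integral_abs_inner_pow_mul_radial [Nontrivial E] (h : E) (p : ℕ) (g : ℝ → ℝ) :
    ∫ x : E, |inner ℝ h x| ^ p * g ‖x‖ =
      (∫ ω : sphere (0 : E) 1, |inner ℝ h (ω : E)| ^ p ∂(volume : Measure E).toSphere) *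
        ∫ r in Ioi (0 : ℝ), r ^ (Module.finrank ℝ E - 1 + p) * g r := by
  calc
    ∫ x : E, |inner ℝ h x| ^ p * g ‖x‖
        = ∫ x : ({(0)}ᶜ : Set E), |inner ℝ h x.1| ^ p * g ‖x.1‖
            ∂((volume : Measure E).comap (↑)) := by
      rw [integral_subtype_comap (measurableSet_singleton _).compl
        fun x : E ↦ |inner ℝ h x| ^ p * g ‖x‖, restrict_compl_singleton]
    _ = ∫ x, |inner ℝ h (x.1 : E)| ^ p * ((x.2 : ℝ) ^ p * g x.2)
          ∂(volume : Measure E).toSphere.prod (.volumeIoiPow (Module.finrank ℝ E - 1)) := by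
      rw [← (volume : Measure E).measurePreserving_homeomorphUnitSphereProd.integral_comp
        (Homeomorph.measurableEmbedding _)]
      refine integral_congr_ae (.of_forall fun x => ?_)
      have hx : ‖(x : E)‖ ≠ 0 := norm_ne_zero_iff.2 x.2
      simp only [homeomorphUnitSphereProd_apply_snd_coe, homeomorphUnitSphereProd_apply_fst_coe,
        inner_smul_right]
      rw [← mul_assoc, ← mul_pow]
      congr 2
      rw [abs_mul, abs_inv, abs_norm]
      field_simp
    _ = (∫ ω : sphere (0 : E) 1, |inner ℝ h (ω : E)| ^ p ∂(volume : Measure E).toSphere) *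
          ∫ r : Ioi (0 : ℝ), ((r : ℝ) ^ p * g r) ∂.volumeIoiPow (Module.finrank ℝ E - 1) :=
      integral_prod_mul (fun ω : sphere (0 : E) 1 => |inner ℝ h (ω : E)| ^ p)
        (fun r : Ioi (0 : ℝ) => (r : ℝ) ^ p * g r)
    _ = _ := by
      congr 1
      simp only [Measure.volumeIoiPow, ENNReal.ofReal]
      rw [integral_withDensity_eq_integral_smul,
        integral_subtype_comap measurableSet_Ioi
          fun a ↦ Real.toNNReal (a ^ (Module.finrank ℝ E - 1)) • (a ^ p * g a),
        setIntegral_congr_fun measurableSet_Ioi fun x hx ↦ ?_]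
      · rw [NNReal.smul_def, Real.coe_toNNReal _ (pow_nonneg hx.out.le _), smul_eq_mul]
        ring
      · exact (measurable_subtype_coe.pow_const _).real_toNNReal

theorem integral_Ioi_pow_mul_exp_neg_sq (m : ℕ) :
    ∫ r in Ioi (0 : ℝ), r ^ m * Real.exp (-r ^ 2) = Real.Gamma ((m + 1) / 2) / 2 := by
  have := integral_rpow_mul_exp_neg_rpow (p := 2) (q := m) two_pos
    (by linarith [m.cast_nonneg (α := ℝ)])
  simp only [Real.rpow_natCast, Real.rpow_ofNat] at this
  rw [this]; ring

theorem integral_abs_pow_mul_exp_neg_sq (m : ℕ) :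
    ∫ r : ℝ, |r| ^ m * Real.exp (-r ^ 2) = Real.Gamma ((m + 1) / 2) := by
  have h := integral_comp_abs (f := fun r : ℝ => r ^ m * Real.exp (-r ^ 2))
  simp only [sq_abs] at h
  rw [h, integral_Ioi_pow_mul_exp_neg_sq]; ring

/-- In an orthonormal basis that starts with `h` the integral is a product of one-dimensional
ones. -/
theorem integral_abs_inner_pow_mul_gaussian {h : E} (hh : ‖h‖ = 1) (p : ℕ) :
    ∫ x : E, |inner ℝ h x| ^ p * Real.exp (-‖x‖ ^ 2) =
      Real.Gamma ((p + 1) / 2) * √Real.pi ^ (Module.finrank ℝ E - 1) := by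
  classical
  have hpos : 0 < Module.finrank ℝ E := by
    have : Nontrivial E := ⟨h, 0, by rintro rfl; simp at hh⟩
    exact Module.finrank_pos
  let i₀ : Fin (Module.finrank ℝ E) := ⟨0, hpos⟩
  obtain ⟨b, hb⟩ := Orthonormal.exists_orthonormalBasis_extension_of_card_eq (𝕜 := ℝ) (E := E)
    (ι := Fin (Module.finrank ℝ E)) (by simp) (v := fun _ => h) (s := {i₀}) (by
      rw [orthonormal_iff_ite]
      rintro ⟨i, rfl⟩ ⟨j, rfl⟩
      simp [hh])
  have hb0 : b i₀ = h := hb i₀ rfl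
  have key : ∫ x : E, |inner ℝ h x| ^ p * Real.exp (-‖x‖ ^ 2) =
      ∫ y : Fin (Module.finrank ℝ E) → ℝ,
        ∏ i, (if i = i₀ then |y i| ^ p else 1) * Real.exp (-y i ^ 2) := by
    rw [← (PiLp.volume_preserving_ofLp (Fin (Module.finrank ℝ E))).integral_comp
      (MeasurableEquiv.toLp 2 _).symm.measurableEmbedding,
      ← b.measurePreserving_repr.integral_comp
        b.repr.toHomeomorph.measurableEmbedding]
    refine integral_congr_ae (.of_forall fun x => ?_)
    simp only
    rw [Finset.prod_mul_distrib, ← Real.exp_sum, Finset.prod_ite_eq' Finset.univ i₀,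
      if_pos (Finset.mem_univ _), b.repr_apply_apply, hb0, Finset.sum_neg_distrib,
      ← b.repr.norm_map x, EuclideanSpace.norm_sq_eq]
    simp
  rw [key, integral_fintype_prod_volume_eq_prod
    (f := fun i (y : ℝ) => (if i = i₀ then |y| ^ p else 1) * Real.exp (-y ^ 2)),
    ← Finset.mul_prod_erase _ _ (Finset.mem_univ i₀)]
  congr 1
  · simpa using integral_abs_pow_mul_exp_neg_sq p
  · rw [Finset.prod_congr rfl (g := fun _ => √Real.pi) fun i hi => ?_]
    · simp
    · simpa [Finset.ne_of_mem_erase hi] using integral_gaussian 1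

/-- The substitution `t = r²` gives half of the Beta integral at `(m + 1) / 2` and `α + 1`. -/
theorem integral_Ioi_pow_mul_ball_weight (m : ℕ) {α : ℝ} (hα : -1 < α) :
    ∫ r in Ioi (0 : ℝ), r ^ m * (if r < 1 then (1 - r ^ 2) ^ α else 0) =
      Real.Gamma ((m + 1) / 2) * Real.Gamma (α + 1) / Real.Gamma ((m + 1) / 2 + α + 1) / 2 := by
  have hm : (0 : ℝ) < (m + 1) / 2 := by positivity
  have hβ : (0 : ℝ) < α + 1 := by linarith
  have h1 : ∫ t in Ioi (0 : ℝ), t ^ ((m + 1 : ℝ) / 2 - 1) * (if t < 1 then (1 - t) ^ α else 0) =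
      ProbabilityTheory.beta ((m + 1) / 2) (α + 1) := by
    rw [ProbabilityTheory.beta_eq_betaIntegralReal _ _ hm hβ, Complex.betaIntegral,
      intervalIntegral.integral_of_le zero_le_one, ← RCLike.re_to_complex, ← integral_re,
      integral_Ioc_eq_integral_Ioo]
    · rw [← Iio_inter_Ioi, ← Measure.restrict_restrict measurableSet_Iio,
        ← integral_indicator measurableSet_Iio]
      refine setIntegral_congr_fun measurableSet_Ioi fun t (ht : 0 < t) => ?_
      simp only [indicator, mem_Iio]
      split_ifs with h
      · norm_cast
        rw [← Complex.ofReal_cpow ht.le, ← Complex.ofReal_cpow (by linarith), RCLike.re_to_complex,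
          Complex.re_mul_ofReal, Complex.ofReal_re]
        simp
      · simp
    · have := Complex.betaIntegral_convergent (u := ((m + 1 : ℝ) / 2 : ℝ)) (v := (α + 1 : ℝ))
        (by simpa using hm) (by simpa using hβ)
      rwa [intervalIntegrable_iff_integrableOn_Ioc_of_le zero_le_one, IntegrableOn] at this
  have h2 := integral_comp_rpow_Ioi_of_pos
    (g := fun t : ℝ => t ^ ((m + 1 : ℝ) / 2 - 1) * (if t < 1 then (1 - t) ^ α else 0)) two_pos
  rw [h1] at h2
  rw [show Real.Gamma ((m + 1) / 2) * Real.Gamma (α + 1) / Real.Gamma ((m + 1) / 2 + α + 1) =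
    ProbabilityTheory.beta ((m + 1) / 2) (α + 1) by rw [ProbabilityTheory.beta, add_assoc], ← h2,
    eq_div_iff two_ne_zero, mul_comm, ← integral_const_mul]
  refine setIntegral_congr_fun measurableSet_Ioi fun t (ht : 0 < t) => ?_
  have e1 : ((t ^ (2 : ℝ)) ^ ((m + 1 : ℝ) / 2 - 1)) = t ^ ((m : ℝ) - 1) := by
    rw [← Real.rpow_mul ht.le]; congr 1; ring
  have e2 : t ^ m = t ^ (2 - 1 : ℝ) * t ^ ((m : ℝ) - 1) := by
    rw [← Real.rpow_add ht, ← Real.rpow_natCast]; congr 1; ring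
  have e3 : t ^ 2 < 1 ↔ t < 1 := sq_lt_one_iff₀ ht.le
  simp only [smul_eq_mul]
  rw [e1, e2]
  simp only [Real.rpow_ofNat, e3]
  ring

/-- The value comes from a comparison with the Gaussian weight: in polar coordinates both integrals
have the same factor over the sphere. -/
theorem setIntegral_abs_inner_pow_mul_weight {h : E} (hh : ‖h‖ = 1) (p : ℕ) {α : ℝ} (hα : -1 < α) :
    ∫ x in ball (0 : E) 1, |inner ℝ h x| ^ p * (1 - ‖x‖ ^ 2) ^ α =
      Real.Gamma ((p + 1) / 2) * √Real.pi ^ (Module.finrank ℝ E - 1) * Real.Gamma (α + 1) /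
        Real.Gamma ((Module.finrank ℝ E + p) / 2 + α + 1) := by
  have : Nontrivial E := ⟨h, 0, by rintro rfl; simp at hh⟩
  have hpos : 0 < Module.finrank ℝ E := Module.finrank_pos
  have e : ((Module.finrank ℝ E - 1 + p : ℕ) : ℝ) + 1 = Module.finrank ℝ E + p := by
    have : Module.finrank ℝ E - 1 + p + 1 = Module.finrank ℝ E + p := by omega
    exact_mod_cast this
  have h1 := integral_abs_inner_pow_mul_gaussian hh p
  rw [integral_abs_inner_pow_mul_radial h p (fun r => Real.exp (-r ^ 2)),
    integral_Ioi_pow_mul_exp_neg_sq, e] at h1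
  have h2 := integral_abs_inner_pow_mul_radial h p (fun r => if r < 1 then (1 - r ^ 2) ^ α else 0)
  rw [integral_Ioi_pow_mul_ball_weight _ hα, e] at h2
  rw [← integral_indicator measurableSet_ball]
  have h3 : (ball (0 : E) 1).indicator (fun x => |inner ℝ h x| ^ p * (1 - ‖x‖ ^ 2) ^ α) =
      fun x => |inner ℝ h x| ^ p * (if ‖x‖ < 1 then (1 - ‖x‖ ^ 2) ^ α else 0) := by
    ext x
    simp [indicator]
  rw [h3, h2, ← h1]
  ring

theorem setIntegral_abs_inner_pow_mul_weight_pos {h : E} (hh : ‖h‖ = 1) (p : ℕ) {α : ℝ}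
    (hα : -1 < α) : 0 < ∫ x in ball (0 : E) 1, |inner ℝ h x| ^ p * (1 - ‖x‖ ^ 2) ^ α := by
  rw [setIntegral_abs_inner_pow_mul_weight hh p hα]
  have h1 : (0 : ℝ) < α + 1 := by linarith
  have h2 : (0 : ℝ) < (Module.finrank ℝ E + p) / 2 + α + 1 := by
    rw [add_assoc]; positivity
  have := Real.Gamma_pos_of_pos h1
  have := Real.Gamma_pos_of_pos h2
  have := Real.Gamma_pos_of_pos (s := ((p : ℝ) + 1) / 2) (by positivity)
  positivity

/-- Integrability follows from the moment formula: a nonintegrable function would have integral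
zero. -/
theorem integrableOn_weight [Nontrivial E] {α : ℝ} (hα : -1 < α) :
    IntegrableOn (fun x : E => (1 - ‖x‖ ^ 2) ^ α) (ball 0 1) := by
  obtain ⟨h, hh⟩ := exists_norm_eq E zero_le_one
  by_contra hc
  have := setIntegral_abs_inner_pow_mul_weight_pos hh 0 hα
  simp only [pow_zero, one_mul] at this
  rw [integral_undef hc] at this
  exact this.false

theorem integrableOn_mul_weight [Nontrivial E] {α : ℝ} (hα : -1 < α) {g : E → ℝ}
    (hg : AEStronglyMeasurable g (volume.restrict (ball 0 1))) {C : ℝ}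
    (hC : ∀ x ∈ ball (0 : E) 1, |g x| ≤ C) :
    IntegrableOn (fun x : E => g x * (1 - ‖x‖ ^ 2) ^ α) (ball 0 1) :=
  (integrableOn_weight hα).bdd_mul (c := C) hg
    ((ae_restrict_iff' measurableSet_ball).2 (.of_forall hC))

end Moments

/-! ### The involutive automorphisms of the ball -/

section Moebius

variable {n : ℕ}

theorem herm_self (z : EuclideanSpace ℂ (Fin n)) : herm z z = (‖z‖ : ℂ) ^ 2 :=
  inner_self_eq_norm_sq_to_K z

theorem herm_conj (z w : EuclideanSpace ℂ (Fin n)) : (starRingEnd ℂ) (herm z w) = herm w z :=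
  inner_conj_symm _ _

theorem herm_sub_left (z z' w : EuclideanSpace ℂ (Fin n)) :
    herm (z - z') w = herm z w - herm z' w := inner_sub_right _ _ _

theorem herm_add_left (z z' w : EuclideanSpace ℂ (Fin n)) :
    herm (z + z') w = herm z w + herm z' w := inner_add_right _ _ _

theorem herm_smul_left (c : ℂ) (z w : EuclideanSpace ℂ (Fin n)) :
    herm (c • z) w = c * herm z w := inner_smul_right _ _ _

theorem herm_sub_right (z w w' : EuclideanSpace ℂ (Fin n)) :
    herm z (w - w') = herm z w - herm z w' := inner_sub_left _ _ _

theorem herm_add_right (z w w' : EuclideanSpace ℂ (Fin n)) :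
    herm z (w + w') = herm z w + herm z w' := inner_add_left _ _ _

theorem herm_smul_right (c : ℂ) (z w : EuclideanSpace ℂ (Fin n)) :
    herm z (c • w) = (starRingEnd ℂ) c * herm z w := inner_smul_left _ _ _

theorem norm_herm_le (z w : EuclideanSpace ℂ (Fin n)) : ‖herm z w‖ ≤ ‖z‖ * ‖w‖ := by
  rw [mul_comm]; exact norm_inner_le_norm _ _

theorem real_inner_eq_re_herm (z w : EuclideanSpace ℂ (Fin n)) : inner ℝ z w = (herm z w).re := by
  rw [herm_eq_sum, PiLp.inner_apply, Complex.re_sum]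
  refine Finset.sum_congr rfl fun k _ => ?_
  rw [Complex.inner, ← Complex.conj_re]
  simp only [map_mul, Complex.conj_conj, Complex.mul_re, Complex.conj_re, Complex.conj_im]
  ring

theorem mem_unitBall {z : EuclideanSpace ℂ (Fin n)} : z ∈ unitBall n ↔ ‖z‖ < 1 := by
  simp [unitBall]

theorem one_sub_norm_sq_pos {z : EuclideanSpace ℂ (Fin n)} (hz : z ∈ unitBall n) :
    0 < 1 - ‖z‖ ^ 2 := by
  have := mem_unitBall.1 hz
  nlinarith [norm_nonneg z]

theorem one_sub_norm_le_norm_one_sub_herm {z w : EuclideanSpace ℂ (Fin n)} (hw : w ∈ unitBall n) :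
    1 - ‖z‖ ≤ ‖1 - herm z w‖ := by
  have h1 := norm_herm_le z w
  have h2 := norm_sub_norm_le 1 (herm z w)
  rw [norm_one] at h2
  have := mem_unitBall.1 hw
  nlinarith [norm_nonneg z]

theorem one_sub_herm_ne_zero {z w : EuclideanSpace ℂ (Fin n)} (hz : z ∈ unitBall n)
    (hw : w ∈ unitBall n) : 1 - herm z w ≠ 0 := by
  have h1 := one_sub_norm_le_norm_one_sub_herm (z := z) hw
  have := mem_unitBall.1 hz
  rw [← norm_pos_iff]; linarith

theorem norm_one_sub_herm_comm (z w : EuclideanSpace ℂ (Fin n)) :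
    ‖1 - herm z w‖ = ‖1 - herm w z‖ := by
  rw [← Complex.norm_conj, map_sub, herm_conj, map_one]

/-- The number `√(1 - |z|²)`. -/
def defect (z : EuclideanSpace ℂ (Fin n)) : ℝ := √(1 - ‖z‖ ^ 2)

theorem defect_pos {z : EuclideanSpace ℂ (Fin n)} (hz : z ∈ unitBall n) : 0 < defect z :=
  Real.sqrt_pos.2 (one_sub_norm_sq_pos hz)

theorem defect_sq {z : EuclideanSpace ℂ (Fin n)} (hz : z ∈ unitBall n) :
    defect z ^ 2 = 1 - ‖z‖ ^ 2 := Real.sq_sqrt (one_sub_norm_sq_pos hz).le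

theorem norm_sq_eq_defect {z : EuclideanSpace ℂ (Fin n)} (hz : z ∈ unitBall n) :
    (‖z‖ : ℂ) ^ 2 = 1 - (defect z : ℂ) ^ 2 := by
  have := defect_sq hz
  have h : ‖z‖ ^ 2 = 1 - defect z ^ 2 := by linarith
  exact_mod_cast h

theorem one_add_defect_ne_zero (z : EuclideanSpace ℂ (Fin n)) : (1 + defect z : ℂ) ≠ 0 := by
  have : 0 ≤ defect z := Real.sqrt_nonneg _
  have h : 1 + defect z ≠ 0 := by positivity
  exact_mod_cast h

/-- The self-adjoint operator `P_z + √(1 - |z|²) (1 - P_z)`, where `P_z` is the orthogonal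
projection onto the complex line through `z`. The formula has no division by `|z|`, because
`(1 - √(1 - |z|²)) / |z|² = 1 / (1 + √(1 - |z|²))`. -/
def tangential (z h : EuclideanSpace ℂ (Fin n)) : EuclideanSpace ℂ (Fin n) :=
  (defect z : ℂ) • h + (herm h z / (1 + defect z)) • z

/-- The involution `φ_z` of the unit ball that exchanges `0` and `z`. -/
def moebius (z w : EuclideanSpace ℂ (Fin n)) : EuclideanSpace ℂ (Fin n) :=
  (1 - herm w z)⁻¹ • (z - tangential z w)

theorem herm_tangential_self {z : EuclideanSpace ℂ (Fin n)} (hz : z ∈ unitBall n)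
    (h : EuclideanSpace ℂ (Fin n)) : herm (tangential z h) z = herm h z := by
  have := one_add_defect_ne_zero z
  rw [tangential, herm_add_left, herm_smul_left, herm_smul_left, herm_self, norm_sq_eq_defect hz]
  field_simp
  ring

theorem herm_tangential_comm (z h w : EuclideanSpace ℂ (Fin n)) :
    herm (tangential z h) w = herm h (tangential z w) := by
  simp only [tangential, herm_add_left, herm_smul_left, herm_add_right, herm_smul_right, map_div₀,
    herm_conj, map_add, map_one, Complex.conj_ofReal]
  ring

theorem norm_tangential_sq {z : EuclideanSpace ℂ (Fin n)} (hz : z ∈ unitBall n)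
    (h : EuclideanSpace ℂ (Fin n)) :
    ‖tangential z h‖ ^ 2 = (1 - ‖z‖ ^ 2) * ‖h‖ ^ 2 + ‖herm h z‖ ^ 2 := by
  have h1 := one_add_defect_ne_zero z
  have key : herm (tangential z h) (tangential z h) =
      (1 - (‖z‖ : ℂ) ^ 2) * (‖h‖ : ℂ) ^ 2 + (‖herm h z‖ : ℂ) ^ 2 := by
    rw [← Complex.conj_mul' (herm h z), herm_conj, ← herm_self h]
    simp only [tangential, herm_add_left, herm_smul_left, herm_add_right, herm_smul_right, map_div₀,
      herm_conj, map_add, map_one, Complex.conj_ofReal, herm_self z, norm_sq_eq_defect hz]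
    field_simp
    ring
  rw [herm_self] at key
  exact_mod_cast key

theorem norm_tangential_le {z : EuclideanSpace ℂ (Fin n)} (hz : z ∈ unitBall n)
    (h : EuclideanSpace ℂ (Fin n)) : ‖tangential z h‖ ≤ ‖h‖ := by
  have h1 := norm_tangential_sq hz h
  have h2 := norm_herm_le h z
  have h3 : ‖herm h z‖ ^ 2 ≤ (‖h‖ * ‖z‖) ^ 2 := by gcongr
  refine le_of_sq_le_sq ?_ (norm_nonneg h)
  nlinarith

theorem tangential_self {z : EuclideanSpace ℂ (Fin n)} (hz : z ∈ unitBall n) :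
    tangential z z = z := by
  have h1 := one_add_defect_ne_zero z
  rw [tangential, herm_self, norm_sq_eq_defect hz, ← add_smul]
  convert one_smul ℂ z using 2
  field_simp
  ring

theorem one_sub_herm_moebius {z w : EuclideanSpace ℂ (Fin n)} (hz : z ∈ unitBall n)
    (hw : w ∈ unitBall n) :
    1 - herm (moebius z w) z = (defect z : ℂ) ^ 2 / (1 - herm w z) := by
  have h1 := one_sub_herm_ne_zero hw hz
  rw [moebius, herm_smul_left, herm_sub_left, herm_tangential_self hz, herm_self,
    norm_sq_eq_defect hz]
  field_simp
  ring

theorem one_sub_norm_moebius_sq {z w : EuclideanSpace ℂ (Fin n)} (hz : z ∈ unitBall n)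
    (hw : w ∈ unitBall n) :
    1 - ‖moebius z w‖ ^ 2 = (1 - ‖z‖ ^ 2) * (1 - ‖w‖ ^ 2) / ‖1 - herm w z‖ ^ 2 := by
  have h1 := one_sub_herm_ne_zero hw hz
  have h2 : ‖z - tangential z w‖ ^ 2 =
      ‖1 - herm w z‖ ^ 2 - (1 - ‖z‖ ^ 2) * (1 - ‖w‖ ^ 2) := by
    have key : herm (z - tangential z w) (z - tangential z w) =
        (‖1 - herm w z‖ : ℂ) ^ 2 - (1 - (‖z‖ : ℂ) ^ 2) * (1 - (‖w‖ : ℂ) ^ 2) := by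
      have h3 := norm_tangential_sq hz w
      have h3' : (‖tangential z w‖ : ℂ) ^ 2 =
        (1 - (‖z‖ : ℂ) ^ 2) * (‖w‖ : ℂ) ^ 2 + (‖herm w z‖ : ℂ) ^ 2 := by exact_mod_cast h3
      rw [herm_sub_left, herm_sub_right, herm_sub_right, herm_tangential_self hz,
        ← herm_conj (tangential z w) z, herm_tangential_self hz, herm_conj, herm_self, herm_self,
        h3', ← Complex.conj_mul', ← Complex.conj_mul', map_sub, herm_conj, map_one]
      ring
    rw [herm_self] at key
    exact_mod_cast key
  have h4 : ‖1 - herm w z‖ ≠ 0 := norm_ne_zero_iff.2 h1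
  rw [moebius, norm_smul, norm_inv, mul_pow, h2]
  field_simp
  ring

theorem moebius_mem {z w : EuclideanSpace ℂ (Fin n)} (hz : z ∈ unitBall n)
    (hw : w ∈ unitBall n) : moebius z w ∈ unitBall n := by
  have h := one_sub_norm_moebius_sq hz hw
  have h1 := norm_pos_iff.2 (one_sub_herm_ne_zero hw hz)
  have h2 := one_sub_norm_sq_pos hz
  have h3 := one_sub_norm_sq_pos hw
  have h4 : 0 < 1 - ‖moebius z w‖ ^ 2 := by rw [h]; positivity
  rw [mem_unitBall]
  nlinarith [norm_nonneg (moebius z w)]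

theorem moebius_moebius {z w : EuclideanSpace ℂ (Fin n)} (hz : z ∈ unitBall n)
    (hw : w ∈ unitBall n) : moebius z (moebius z w) = w := by
  have h1 := one_sub_herm_ne_zero hw hz
  have h2 := one_sub_herm_moebius hz hw
  have h3 : herm (moebius z w) z = 1 - (defect z : ℂ) ^ 2 / (1 - herm w z) := by
    rw [← h2]; ring
  have hs : (defect z : ℂ) ≠ 0 := by exact_mod_cast (defect_pos hz).ne'
  have hs' := one_add_defect_ne_zero z
  rw [moebius, h2, tangential, h3, moebius, tangential]
  match_scalars <;> field_simp
  ring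

theorem hasFDerivAt_herm (z : EuclideanSpace ℂ (Fin n)) (w : EuclideanSpace ℂ (Fin n)) :
    HasFDerivAt (𝕜 := ℂ) (fun w => herm w z) (innerSL ℂ z) w :=
  (innerSL ℂ z).hasFDerivAt

/-- The derivative of `φ_z` at `w`: a multiple of the identity plus an operator of rank one. -/
def moebiusDeriv (z w : EuclideanSpace ℂ (Fin n)) :
    EuclideanSpace ℂ (Fin n) →L[ℂ] EuclideanSpace ℂ (Fin n) :=
  (-(defect z : ℂ) / (1 - herm w z)) • ContinuousLinearMap.id ℂ _ +
    (innerSL ℂ z).smulRight ((1 - herm w z)⁻¹ ^ 2 • (z - tangential z w) -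
      ((1 - herm w z)⁻¹ / (1 + defect z)) • z)

theorem hasFDerivAt_moebius {z w : EuclideanSpace ℂ (Fin n)} (hz : z ∈ unitBall n)
    (hw : w ∈ unitBall n) : HasFDerivAt (moebius z) (moebiusDeriv z w) w := by
  have h1 := one_sub_herm_ne_zero hw hz
  have hd : HasFDerivAt (𝕜 := ℂ) (fun w => 1 - herm w z) (-(innerSL ℂ z)) w :=
    (hasFDerivAt_herm z w).const_sub 1
  have hdi := (hasDerivAt_inv h1).comp_hasFDerivAt w hd
  have hA : HasFDerivAt (𝕜 := ℂ) (fun w => z - tangential z w)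
      (-((defect z : ℂ) • ContinuousLinearMap.id ℂ _ +
        ((1 + defect z : ℂ)⁻¹ • innerSL ℂ z).smulRight z)) w := by
    refine HasFDerivAt.const_sub ?_ z
    refine ((hasFDerivAt_id w).const_smul (defect z : ℂ)).add ?_
    have := ((hasFDerivAt_herm z w).const_mul ((1 + defect z : ℂ)⁻¹)).smul_const z
    simpa only [div_eq_inv_mul] using this
  refine (hdi.smul hA).congr_fderiv ?_
  ext1 h
  simp only [moebiusDeriv, add_apply, smul_apply,
    neg_apply, ContinuousLinearMap.smulRight_apply,
    ContinuousLinearMap.id_apply, innerSL_apply_apply, smul_eq_mul, Function.comp_apply]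
  match_scalars <;> field_simp
  ring

/-- The derivative is a scalar times a transvection, whose determinant is `1` plus the value of the
functional at the vector. -/
theorem det_moebiusDeriv {z w : EuclideanSpace ℂ (Fin n)} (hz : z ∈ unitBall n)
    (hw : w ∈ unitBall n) :
    LinearMap.det (moebiusDeriv z w : EuclideanSpace ℂ (Fin n) →ₗ[ℂ] EuclideanSpace ℂ (Fin n)) =
      (-1) ^ n * ((defect z : ℂ) / (1 - herm w z)) ^ (n + 1) := by
  have h1 := one_sub_herm_ne_zero hw hz
  have hs : (defect z : ℂ) ≠ 0 := by exact_mod_cast (defect_pos hz).ne'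
  have hs' := one_add_defect_ne_zero z
  set c : ℂ := -(defect z : ℂ) / (1 - herm w z) with hc
  have hc0 : c ≠ 0 := div_ne_zero (neg_ne_zero.2 hs) h1
  set u := (1 - herm w z)⁻¹ ^ 2 • (z - tangential z w) -
      ((1 - herm w z)⁻¹ / (1 + defect z)) • z with hu
  have hD : (moebiusDeriv z w : EuclideanSpace ℂ (Fin n) →ₗ[ℂ] EuclideanSpace ℂ (Fin n)) =
      c • LinearMap.transvection (innerSL ℂ z : EuclideanSpace ℂ (Fin n) →ₗ[ℂ] ℂ) (c⁻¹ • u) := by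
    ext1 h
    simp only [moebiusDeriv, ContinuousLinearMap.coe_coe, LinearMap.smul_apply,
      LinearMap.transvection.apply, add_apply, smul_apply,
      ContinuousLinearMap.smulRight_apply, ContinuousLinearMap.id_apply, innerSL_apply_apply,
      ← hc, ← hu]
    rw [smul_add, smul_comm c, smul_inv_smul₀ hc0]
  have hzu : inner ℂ z u = herm u z := rfl
  rw [hD, LinearMap.det_smul, LinearMap.transvection.det, finrank_euclideanSpace_fin]
  simp only [ContinuousLinearMap.coe_coe, innerSL_apply_apply, inner_smul_right, hzu]
  rw [hu, herm_sub_left, herm_smul_left, herm_smul_left, herm_sub_left, herm_tangential_self hz,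
    herm_self, norm_sq_eq_defect hz]
  have : 1 + c⁻¹ * ((1 - herm w z)⁻¹ ^ 2 * (1 - (defect z : ℂ) ^ 2 - herm w z) -
      (1 - herm w z)⁻¹ / (1 + defect z) * (1 - (defect z : ℂ) ^ 2)) =
        (defect z : ℂ) / (1 - herm w z) := by
    rw [hc]
    field_simp
    ring
  rw [this, hc, neg_div, neg_pow]
  ring

/-- The real determinant of a complex linear map is the squared modulus of the complex one. -/
theorem abs_det_restrictScalars_moebiusDeriv {z w : EuclideanSpace ℂ (Fin n)}
    (hz : z ∈ unitBall n) (hw : w ∈ unitBall n) :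
    |((moebiusDeriv z w).restrictScalars ℝ).det| =
      ((1 - ‖z‖ ^ 2) / ‖1 - herm w z‖ ^ 2) ^ (n + 1) := by
  have : ((moebiusDeriv z w).restrictScalars ℝ).det =
      Algebra.norm ℝ (LinearMap.det
        (moebiusDeriv z w : EuclideanSpace ℂ (Fin n) →ₗ[ℂ] EuclideanSpace ℂ (Fin n))) :=
    LinearMap.det_restrictScalars
  rw [this, det_moebiusDeriv hz hw, Algebra.norm_complex_apply, Complex.normSq_eq_norm_sq,
    abs_of_nonneg (by positivity), norm_mul, norm_pow, norm_neg, norm_one, one_pow, one_mul,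
    norm_pow, norm_div, Complex.norm_real, Real.norm_of_nonneg (defect_pos hz).le, ← pow_mul,
    mul_comm (n + 1) 2, pow_mul, div_pow, defect_sq hz]

theorem measurableSet_unitBall : MeasurableSet (unitBall n) := measurableSet_ball

theorem moebius_injOn {z : EuclideanSpace ℂ (Fin n)} (hz : z ∈ unitBall n) :
    InjOn (moebius z) (unitBall n) := fun a ha b hb hab => by
  rw [← moebius_moebius hz ha, hab, moebius_moebius hz hb]

theorem moebius_image {z : EuclideanSpace ℂ (Fin n)} (hz : z ∈ unitBall n) :
    moebius z '' unitBall n = unitBall n := by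
  refine Subset.antisymm (image_subset_iff.2 fun w hw => moebius_mem hz hw) fun w hw =>
    ⟨moebius z w, moebius_mem hz hw, moebius_moebius hz hw⟩

theorem integral_ballVolume_comp_moebius {z : EuclideanSpace ℂ (Fin n)} (hz : z ∈ unitBall n)
    (g : EuclideanSpace ℂ (Fin n) → ℝ) :
    ∫ w, g w ∂(ballVolume n) =
      ∫ ζ, ((1 - ‖z‖ ^ 2) / ‖1 - herm ζ z‖ ^ 2) ^ (n + 1) * g (moebius z ζ) ∂(ballVolume n) := by
  have h := integral_image_eq_integral_abs_det_fderiv_smul volume (measurableSet_unitBall (n := n))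
    (fun w hw => ((hasFDerivAt_moebius hz hw).restrictScalars ℝ).hasFDerivWithinAt)
    (moebius_injOn hz) g
  rw [moebius_image hz] at h
  rw [ballVolume, h]
  refine setIntegral_congr_fun measurableSet_unitBall fun w hw => ?_
  simp only [abs_det_restrictScalars_moebiusDeriv hz hw, smul_eq_mul]

end Moebius

/-! ### Differentiation of the Berezin transform -/

section Derivative

variable {n : ℕ}

/-- The kernel `(1 - |z|²)ⁿ⁺¹ / |1 - ⟨z, w⟩|²ⁿ⁺²`, written as a power. -/
def kernel (z w : EuclideanSpace ℂ (Fin n)) : ℝ := ((1 - ‖z‖ ^ 2) / ‖1 - herm z w‖ ^ 2) ^ (n + 1)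

/-- The logarithmic gradient in `z` of the kernel, divided by `2 (n + 1)`. -/
def logGrad (z w : EuclideanSpace ℂ (Fin n)) : EuclideanSpace ℂ (Fin n) :=
  (1 - herm w z)⁻¹ • w - (1 - ‖z‖ ^ 2)⁻¹ • z

theorem kernel_eq (z w : EuclideanSpace ℂ (Fin n)) :
    kernel z w = (1 - ‖z‖ ^ 2) ^ (n + 1) / ‖1 - herm z w‖ ^ (2 * n + 2) := by
  rw [kernel, div_pow, ← pow_mul]; rfl

theorem kernel_pos {z w : EuclideanSpace ℂ (Fin n)} (hz : z ∈ unitBall n) (hw : w ∈ unitBall n) :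
    0 < kernel z w := by
  have h1 := one_sub_norm_sq_pos hz
  have h2 := norm_pos_iff.2 (one_sub_herm_ne_zero hz hw)
  unfold kernel
  positivity

theorem real_inner_logGrad (z w h : EuclideanSpace ℂ (Fin n)) :
    inner ℝ (logGrad z w) h =
      ((1 - herm z w) * herm w h).re / ‖1 - herm z w‖ ^ 2 - inner ℝ z h / (1 - ‖z‖ ^ 2) := by
  rw [logGrad, inner_sub_left, real_inner_smul_left, real_inner_eq_re_herm, herm_smul_left,
    Complex.inv_def, map_sub, map_one, herm_conj, mul_right_comm, Complex.re_mul_ofReal,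
    Complex.normSq_eq_norm_sq, norm_one_sub_herm_comm w z]
  ring

theorem hasFDerivAt_kernel {z w : EuclideanSpace ℂ (Fin n)} (hz : z ∈ unitBall n)
    (hw : w ∈ unitBall n) :
    HasFDerivAt (fun z => kernel z w)
      ((2 * (n + 1) * kernel z w) • innerSL ℝ (logGrad z w)) z := by
  have h1 := one_sub_herm_ne_zero hz hw
  have h2 : ‖1 - herm z w‖ ≠ 0 := norm_ne_zero_iff.2 h1
  have h3 : 1 - ‖z‖ ^ 2 ≠ 0 := (one_sub_norm_sq_pos hz).ne'
  have hN : HasFDerivAt (fun z : EuclideanSpace ℂ (Fin n) => 1 - ‖z‖ ^ 2)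
      (-(2 • innerSL ℝ z)) z :=
    ((hasStrictFDerivAt_norm_sq z).hasFDerivAt).const_sub 1
  have hD := (((hasFDerivAt_herm w z).restrictScalars ℝ).const_sub 1).norm_sq
  have hDi := (hasDerivAt_inv (pow_ne_zero 2 h2)).comp_hasFDerivAt z hD
  refine ((hN.mul hDi).pow (n + 1)).congr_fderiv ?_
  ext1 h
  have h4 : inner ℂ w h = herm h w := rfl
  simp only [add_apply, smul_apply, neg_apply, innerSL_apply_apply, smul_eq_mul,
    Function.comp_apply, real_inner_logGrad, kernel, ContinuousLinearMap.comp_apply,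
    ContinuousLinearMap.coe_restrictScalars', h4, nsmul_eq_mul, Complex.inner, Pi.mul_apply]
  have h5 : ((1 - herm z w) * herm w h).re = (herm h w * (starRingEnd ℂ) (1 - herm z w)).re := by
    rw [← Complex.conj_re, map_mul, herm_conj, mul_comm]
  rw [h5]
  simp only [Nat.add_sub_cancel, Nat.cast_add, Nat.cast_one, Nat.cast_ofNat, neg_mul,
    mul_neg, Complex.neg_re, pow_succ ((1 - ‖z‖ ^ 2) / ‖1 - herm z w‖ ^ 2) n,
    ← div_eq_mul_inv]
  field_simp
  ring

theorem continuous_herm_left (z : EuclideanSpace ℂ (Fin n)) : Continuous fun w => herm w z :=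
  (innerSL ℂ z).continuous

theorem continuous_herm_right (z : EuclideanSpace ℂ (Fin n)) : Continuous fun w => herm z w :=
  continuous_id.inner continuous_const

theorem measurable_kernel (z : EuclideanSpace ℂ (Fin n)) : Measurable (kernel z) := by
  have := (continuous_herm_right z).measurable
  unfold kernel
  fun_prop

theorem measurable_logGrad (z : EuclideanSpace ℂ (Fin n)) : Measurable (logGrad z) := by
  have := (continuous_herm_left z).measurable
  unfold logGrad
  fun_prop

theorem kernel_le {ρ : ℝ} (hρ : ρ < 1) {z w : EuclideanSpace ℂ (Fin n)} (hz : ‖z‖ ≤ ρ)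
    (hw : w ∈ unitBall n) : kernel z w ≤ (1 / (1 - ρ) ^ 2) ^ (n + 1) := by
  have h1 := one_sub_norm_le_norm_one_sub_herm (z := z) hw
  have h2 : 0 < 1 - ρ := by linarith
  have h3 : 0 ≤ 1 - ‖z‖ ^ 2 := by nlinarith [norm_nonneg z]
  unfold kernel
  gcongr
  · nlinarith [norm_nonneg z]
  · linarith

theorem norm_logGrad_le {ρ : ℝ} (hρ : ρ < 1) {z w : EuclideanSpace ℂ (Fin n)} (hz : ‖z‖ ≤ ρ)
    (hw : w ∈ unitBall n) : ‖logGrad z w‖ ≤ 2 / (1 - ρ) := by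
  have h1 := one_sub_norm_le_norm_one_sub_herm (z := z) hw
  rw [norm_one_sub_herm_comm] at h1
  have h2 : 0 < 1 - ρ := by linarith
  have h3 : 1 - ρ ≤ 1 - ‖z‖ ^ 2 := by nlinarith [norm_nonneg z]
  have h4 := mem_unitBall.1 hw
  calc ‖logGrad z w‖ ≤ ‖(1 - herm w z)⁻¹ • w‖ + ‖(1 - ‖z‖ ^ 2)⁻¹ • z‖ := norm_sub_le _ _
    _ = ‖1 - herm w z‖⁻¹ * ‖w‖ + (1 - ‖z‖ ^ 2)⁻¹ * ‖z‖ := by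
      rw [norm_smul, norm_smul, norm_inv, norm_inv, Real.norm_of_nonneg (h2.le.trans h3)]
    _ ≤ (1 - ρ)⁻¹ * 1 + (1 - ρ)⁻¹ * 1 := by
      gcongr
      · linarith
      · linarith
    _ = 2 / (1 - ρ) := by ring

theorem continuousAt_logGrad {z w : EuclideanSpace ℂ (Fin n)} (hz : z ∈ unitBall n)
    (hw : w ∈ unitBall n) : ContinuousAt (fun z => logGrad z w) z := by
  have h1 := one_sub_herm_ne_zero hw hz
  have h3 : 1 - ‖z‖ ^ 2 ≠ 0 := (one_sub_norm_sq_pos hz).ne'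
  have h4 := (continuous_herm_right w).continuousAt (x := z)
  unfold logGrad
  refine ContinuousAt.sub (((continuousAt_const.sub h4).inv₀ h1).smul continuousAt_const)
    ((ContinuousAt.inv₀ (f := fun z : EuclideanSpace ℂ (Fin n) => 1 - ‖z‖ ^ 2) (by fun_prop)
      h3).smul continuousAt_id)

/-- The integrand of the derivative of `B_α f`, without the factor `c_α`. -/
def derivIntegrand (α : ℝ) (f : EuclideanSpace ℂ (Fin n) → ℝ) (z w : EuclideanSpace ℂ (Fin n)) :
    EuclideanSpace ℂ (Fin n) →L[ℝ] ℝ :=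
  (2 * (n + 1) * kernel z w * f w * (1 - ‖w‖ ^ 2) ^ α) • innerSL ℝ (logGrad z w)

theorem ae_ballVolume {p : EuclideanSpace ℂ (Fin n) → Prop} (h : ∀ w ∈ unitBall n, p w) :
    ∀ᵐ w ∂(ballVolume n), p w :=
  (ae_restrict_iff' measurableSet_unitBall).2 (.of_forall h)

theorem ae_mem_unitBall : ∀ᵐ w ∂(ballVolume n), w ∈ unitBall n := ae_ballVolume fun _ => id

theorem exists_ae_abs_le {f : EuclideanSpace ℂ (Fin n) → ℝ} (hf : MemLp f ∞ (ballVolume n)) :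
    ∃ C : ℝ, 0 ≤ C ∧ ∀ᵐ w ∂(ballVolume n), |f w| ≤ C := by
  refine ⟨(eLpNorm f ∞ (ballVolume n)).toReal, ENNReal.toReal_nonneg, ?_⟩
  have h := ae_le_eLpNormEssSup (f := f) (μ := ballVolume n)
  filter_upwards [h] with w hw
  rw [← eLpNorm_exponent_top] at hw
  have := ENNReal.toReal_mono hf.2.ne hw
  simpa using this

theorem aestronglyMeasurable_weight (α : ℝ) :
    AEStronglyMeasurable (fun w : EuclideanSpace ℂ (Fin n) => (1 - ‖w‖ ^ 2) ^ α)
      (ballVolume n) := by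
  refine Measurable.aestronglyMeasurable ?_
  fun_prop

theorem aestronglyMeasurable_derivIntegrand (α : ℝ) {f : EuclideanSpace ℂ (Fin n) → ℝ}
    (hf : MemLp f ∞ (ballVolume n)) (z : EuclideanSpace ℂ (Fin n)) :
    AEStronglyMeasurable (derivIntegrand α f z) (ballVolume n) := by
  have h1 : AEStronglyMeasurable (fun w => 2 * (n + 1) * kernel z w * f w * (1 - ‖w‖ ^ 2) ^ α)
      (ballVolume n) :=
    ((aestronglyMeasurable_const.mul (measurable_kernel z).aestronglyMeasurable).mul
      hf.1).mul (aestronglyMeasurable_weight α)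
  exact h1.smul ((innerSL ℝ).continuous.comp_aestronglyMeasurable
    (measurable_logGrad z).aestronglyMeasurable)

theorem norm_derivIntegrand_le (α : ℝ) {f : EuclideanSpace ℂ (Fin n) → ℝ} {C ρ : ℝ} (hρ : ρ < 1)
    {z w : EuclideanSpace ℂ (Fin n)} (hz : ‖z‖ ≤ ρ) (hw : w ∈ unitBall n) (hfw : |f w| ≤ C) :
    ‖derivIntegrand α f z w‖ ≤
      2 * (n + 1) * (1 / (1 - ρ) ^ 2) ^ (n + 1) * C * (2 / (1 - ρ)) * (1 - ‖w‖ ^ 2) ^ α := by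
  have h1 := kernel_le hρ hz hw
  have h2 := norm_logGrad_le hρ hz hw
  have h3 := (kernel_pos (mem_unitBall.2 (hz.trans_lt hρ)) hw).le
  have h4 := (weight_pos hw α).le
  have h5 : 0 ≤ C := (abs_nonneg _).trans hfw
  rw [derivIntegrand, norm_smul, innerSL_apply_norm, norm_mul, norm_mul, norm_mul,
    Real.norm_of_nonneg h4, Real.norm_of_nonneg h3, Real.norm_of_nonneg (by positivity),
    Real.norm_eq_abs (f w), mul_right_comm]
  gcongr

theorem aestronglyMeasurable_berezin_integrand (α : ℝ) {f : EuclideanSpace ℂ (Fin n) → ℝ}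
    (hf : MemLp f ∞ (ballVolume n)) (z : EuclideanSpace ℂ (Fin n)) :
    AEStronglyMeasurable (fun w => kernel z w * f w * (1 - ‖w‖ ^ 2) ^ α) (ballVolume n) :=
  ((measurable_kernel z).aestronglyMeasurable.mul hf.1).mul (aestronglyMeasurable_weight α)

theorem berezin_eq (α : ℝ) (f : EuclideanSpace ℂ (Fin n) → ℝ) (z : EuclideanSpace ℂ (Fin n)) :
    berezin n α f z =
      normConst n α * ∫ w, kernel z w * f w * (1 - ‖w‖ ^ 2) ^ α ∂(ballVolume n) := by
  simp only [berezin, kernel_eq]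

variable [NeZero n]

theorem integrable_weight {α : ℝ} (hα : -1 < α) :
    Integrable (fun w : EuclideanSpace ℂ (Fin n) => (1 - ‖w‖ ^ 2) ^ α) (ballVolume n) :=
  integrableOn_weight hα

theorem integrable_derivIntegrand {α : ℝ} (hα : -1 < α) {f : EuclideanSpace ℂ (Fin n) → ℝ}
    (hf : MemLp f ∞ (ballVolume n)) {z : EuclideanSpace ℂ (Fin n)} (hz : z ∈ unitBall n) :
    Integrable (derivIntegrand α f z) (ballVolume n) := by
  obtain ⟨C, -, hC⟩ := exists_ae_abs_le hf
  refine ((integrable_weight hα).const_mul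
    (2 * (n + 1) * (1 / (1 - ‖z‖) ^ 2) ^ (n + 1) * C * (2 / (1 - ‖z‖)))).mono'
    (aestronglyMeasurable_derivIntegrand α hf z) ?_
  filter_upwards [hC, ae_mem_unitBall] with w h1 h2
  exact norm_derivIntegrand_le α (mem_unitBall.1 hz) le_rfl h2 h1

theorem hasFDerivAt_berezin {α : ℝ} (hα : -1 < α) {f : EuclideanSpace ℂ (Fin n) → ℝ}
    (hf : MemLp f ∞ (ballVolume n)) {z : EuclideanSpace ℂ (Fin n)} (hz : z ∈ unitBall n) :
    HasFDerivAt (berezin n α f)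
      (normConst n α • ∫ w, derivIntegrand α f z w ∂(ballVolume n)) z := by
  obtain ⟨C, hC0, hC⟩ := exists_ae_abs_le hf
  have hz' := mem_unitBall.1 hz
  set ρ := (1 + ‖z‖) / 2 with hρ
  have hρ1 : ρ < 1 := by rw [hρ]; linarith
  have hzρ : ‖z‖ < ρ := by rw [hρ]; linarith
  have hs : ball (0 : EuclideanSpace ℂ (Fin n)) ρ ∈ nhds z :=
    isOpen_ball.mem_nhds (by simpa using hzρ)
  rw [show berezin n α f = fun z => normConst n α * ∫ w, kernel z w * f w * (1 - ‖w‖ ^ 2) ^ α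
    ∂(ballVolume n) from funext (berezin_eq α f)]
  refine HasFDerivAt.const_mul ?_ _
  refine hasFDerivAt_integral_of_dominated_of_fderiv_le (F' := derivIntegrand α f)
    (bound := fun w => 2 * (n + 1) * (1 / (1 - ρ) ^ 2) ^ (n + 1) * C * (2 / (1 - ρ)) *
      (1 - ‖w‖ ^ 2) ^ α) hs
    (.of_forall fun z => aestronglyMeasurable_berezin_integrand α hf z) ?_
    (aestronglyMeasurable_derivIntegrand α hf z) ?_ ((integrable_weight hα).const_mul _) ?_
  · refine ((integrable_weight hα).const_mul ((1 / (1 - ρ) ^ 2) ^ (n + 1) * C)).mono'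
      (aestronglyMeasurable_berezin_integrand α hf z) ?_
    filter_upwards [hC, ae_mem_unitBall] with w h1 h2
    have h3 := kernel_le hρ1 hzρ.le h2
    have h4 := (kernel_pos hz h2).le
    have h5 := (weight_pos h2 α).le
    rw [norm_mul, norm_mul, Real.norm_of_nonneg h4, Real.norm_of_nonneg h5, Real.norm_eq_abs]
    gcongr
  · filter_upwards [hC, ae_mem_unitBall] with w h1 h2 x hx
    exact norm_derivIntegrand_le α hρ1 (mem_ball_zero_iff.1 hx).le h2 h1
  · filter_upwards [ae_mem_unitBall] with w h2 x hx
    have hx' : x ∈ unitBall n := mem_unitBall.2 (lt_trans (by simpa using hx) hρ1)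
    have := ((hasFDerivAt_kernel hx' h2).mul_const (f w)).mul_const ((1 - ‖w‖ ^ 2) ^ α)
    refine this.congr_fderiv ?_
    rw [derivIntegrand, smul_smul, smul_smul]
    congr 1
    ring

theorem continuousOn_integral_derivIntegrand {α : ℝ} (hα : -1 < α)
    {f : EuclideanSpace ℂ (Fin n) → ℝ} (hf : MemLp f ∞ (ballVolume n)) :
    ContinuousOn (fun z => ∫ w, derivIntegrand α f z w ∂(ballVolume n)) (unitBall n) := by
  obtain ⟨C, hC0, hC⟩ := exists_ae_abs_le hf
  intro z hz
  have hz' := mem_unitBall.1 hz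
  set ρ := (1 + ‖z‖) / 2 with hρ
  have hρ1 : ρ < 1 := by rw [hρ]; linarith
  have hzρ : ‖z‖ < ρ := by rw [hρ]; linarith
  have hs : ball (0 : EuclideanSpace ℂ (Fin n)) ρ ∈ nhds z :=
    isOpen_ball.mem_nhds (by simpa using hzρ)
  refine ContinuousAt.continuousWithinAt ?_
  refine continuousAt_of_dominated (bound := fun w => 2 * (n + 1) * (1 / (1 - ρ) ^ 2) ^ (n + 1) *
      C * (2 / (1 - ρ)) * (1 - ‖w‖ ^ 2) ^ α)
    (.of_forall fun z => aestronglyMeasurable_derivIntegrand α hf z) ?_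
    ((integrable_weight hα).const_mul _) ?_
  · filter_upwards [hs] with x hx
    filter_upwards [hC, ae_mem_unitBall] with w h1 h2
    exact norm_derivIntegrand_le α hρ1 (mem_ball_zero_iff.1 hx).le h2 h1
  · filter_upwards [ae_mem_unitBall] with w h2
    have h3 := (hasFDerivAt_kernel hz h2).continuousAt
    have h4 := continuousAt_logGrad hz h2
    unfold derivIntegrand
    exact (((continuousAt_const.mul h3).mul continuousAt_const).mul continuousAt_const).smul
      ((innerSL ℝ).continuous.continuousAt.comp h4)

theorem fderiv_berezin {α : ℝ} (hα : -1 < α) {f : EuclideanSpace ℂ (Fin n) → ℝ}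
    (hf : MemLp f ∞ (ballVolume n)) {z : EuclideanSpace ℂ (Fin n)} (hz : z ∈ unitBall n)
    (h : EuclideanSpace ℂ (Fin n)) :
    fderiv ℝ (berezin n α f) z h = 2 * normConst n α * (n + 1) *
      ∫ w, kernel z w * f w * (1 - ‖w‖ ^ 2) ^ α * inner ℝ (logGrad z w) h ∂(ballVolume n) := by
  rw [(hasFDerivAt_berezin hα hf hz).fderiv, smul_apply,
    ContinuousLinearMap.integral_apply (integrable_derivIntegrand hα hf hz), smul_eq_mul,
    ← integral_const_mul, ← integral_const_mul]
  refine integral_congr_ae (.of_forall fun w => ?_)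
  simp only [derivIntegrand, smul_apply, innerSL_apply_apply, smul_eq_mul]
  ring

theorem continuousOn_fderiv_berezin {α : ℝ} (hα : -1 < α)
    {f : EuclideanSpace ℂ (Fin n) → ℝ} (hf : MemLp f ∞ (ballVolume n)) :
    ContinuousOn (fderiv ℝ (berezin n α f)) (unitBall n) :=
  ((continuousOn_integral_derivIntegrand hα hf).const_smul (normConst n α)).congr
    fun _ hz => (hasFDerivAt_berezin hα hf hz).fderiv

theorem contDiffOn_berezin {α : ℝ} (hα : -1 < α)
    {f : EuclideanSpace ℂ (Fin n) → ℝ} (hf : MemLp f ∞ (ballVolume n)) :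
    ContDiffOn ℝ 1 (berezin n α f) (unitBall n) :=
  (contDiffOn_succ_iff_fderiv_of_isOpen (n := 0) isOpen_ball).2
    ⟨fun _ hz => (hasFDerivAt_berezin hα hf hz).differentiableAt.differentiableWithinAt,
      by simp, contDiffOn_zero.2 (continuousOn_fderiv_berezin hα hf)⟩

end Derivative

/-! ### Binomial series -/

section Series

theorem multichoose_succ (a : ℝ) (k : ℕ) :
    Ring.multichoose a (k + 1) = Ring.multichoose a k * (a + k) / (k + 1) := by
  have h (j : ℕ) : (j.factorial : ℝ) * Ring.multichoose a j = (ascPochhammer ℝ j).eval a := by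
    rw [← nsmul_eq_mul, Ring.factorial_nsmul_multichoose_eq_ascPochhammer,
      Polynomial.ascPochhammer_smeval_eq_eval]
  have h1 := h (k + 1)
  rw [ascPochhammer_succ_eval, ← h k, Nat.factorial_succ, Nat.cast_mul, Nat.cast_succ] at h1
  have h2 : (k.factorial : ℝ) ≠ 0 := by exact_mod_cast k.factorial_ne_zero
  have h3 : (k + 1 : ℝ) ≠ 0 := by positivity
  rw [eq_div_iff h3]
  apply mul_left_cancel₀ h2
  linear_combination h1

theorem multichoose_pos {a : ℝ} (ha : 0 < a) (k : ℕ) : 0 < Ring.multichoose a k := by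
  induction k with
  | zero => simp
  | succ k ih => rw [multichoose_succ]; positivity

theorem hasSum_multichoose {x : ℝ} (hx : |x| < 1) (a : ℝ) :
    HasSum (fun k => Ring.multichoose a k * x ^ k) ((1 - x) ^ (-a)) := by
  have h := (Real.one_div_one_sub_rpow_hasFPowerSeriesOnBall_zero a).hasSum (y := x)
    (by simpa [enorm_eq_nnnorm, ← NNReal.coe_lt_one] using hx)
  rw [zero_add, one_div, ← Real.rpow_neg (by linarith [le_abs_self x])] at h
  simpa [Ring.multichoose_eq, FormalMultilinearSeries.ofScalars_apply_eq, mul_comm] using h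

theorem hasSum_multichoose_even {x : ℝ} (hx : |x| < 1) (a : ℝ) :
    HasSum (fun k => Ring.multichoose a (2 * k) * x ^ (2 * k))
      (((1 - x) ^ (-a) + (1 + x) ^ (-a)) / 2) := by
  have h1 := hasSum_multichoose hx a
  have h2 := hasSum_multichoose (x := -x) (by simpa using hx) a
  rw [sub_neg_eq_add] at h2
  have h3 := (h1.add h2).div_const 2
  rw [← (mul_right_injective₀ (two_ne_zero (α := ℕ))).hasSum_iff (fun k hk => ?_)] at h3
  · convert! h3 using 1
    ext k
    simp only [Function.comp_apply, (even_two_mul k).neg_pow]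
    ring
  · have : Odd k := by
      rw [← Nat.not_even_iff_odd]
      rintro ⟨m, rfl⟩
      exact hk ⟨m, by ring⟩
    rw [this.neg_pow]; ring

/-- If `a_k ≤ M b_k` for the coefficients `b_k` of `(1 - t)^(-α)`, strictly for one index and with
a smaller constant for large `k`, then the quotient of the two power series stays away from `M`. -/
theorem exists_lt_mul_tsum_le {α : ℝ} (hα : 0 < α) {a : ℕ → ℝ} (ha : ∀ k, 0 ≤ a k) {M M₂ : ℝ}
    (hM : M₂ < M) {K j : ℕ} (h1 : ∀ k, a k ≤ M * Ring.multichoose α k)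
    (h2 : ∀ k, K ≤ k → a k ≤ M₂ * Ring.multichoose α k) (h3 : a j < M * Ring.multichoose α j)
    {δ : ℝ} (hδ : 0 ≤ δ) (hδj : 0 < δ ^ j) :
    ∃ M' < M, ∀ t, δ ≤ t → t < 1 → (1 - t) ^ α * ∑' k, a k * t ^ k ≤ M' := by
  set S := ∑ k ∈ Finset.range K, Ring.multichoose α k with hS
  have hS0 : 0 ≤ S := Finset.sum_nonneg fun k _ => (multichoose_pos hα k).le
  set D := (M * Ring.multichoose α j - a j) * δ ^ j with hD
  have hD0 : 0 < D := mul_pos (by linarith) hδj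
  have hε : 0 < M - M₂ := by linarith
  set c := (M - M₂) / (1 + (M - M₂) * S / D) with hc
  have hden : 0 < 1 + (M - M₂) * S / D := by positivity
  have hc0 : 0 < c := by positivity
  refine ⟨M - c, by linarith, fun t ht ht1 => ?_⟩
  have ht0 : 0 ≤ t := hδ.trans ht
  have hB := hasSum_multichoose (x := t) (by rwa [abs_of_nonneg ht0]) α
  have hsum : Summable fun k => a k * t ^ k := by
    refine Summable.of_nonneg_of_le (fun k => mul_nonneg (ha k) (pow_nonneg ht0 k)) (fun k => ?_)
      (hB.summable.mul_left M)
    rw [← mul_assoc]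
    exact mul_le_mul_of_nonneg_right (h1 k) (pow_nonneg ht0 k)
  have hX := (hB.mul_left M).sub hsum.hasSum
  set B := (1 - t) ^ (-α) with hBdef
  set A := ∑' k, a k * t ^ k
  have hterm (k : ℕ) : 0 ≤ M * (Ring.multichoose α k * t ^ k) - a k * t ^ k := by
    rw [← mul_assoc, ← sub_mul]
    exact mul_nonneg (by linarith [h1 k]) (pow_nonneg ht0 k)
  have e1 : D ≤ M * B - A := by
    refine le_trans ?_ (le_hasSum hX j fun k _ => hterm k)
    rw [← mul_assoc, ← sub_mul, hD]
    have := h1 j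
    gcongr
  have hfin : HasSum (fun k => if k ∈ Finset.range K then Ring.multichoose α k * t ^ k else 0)
      (∑ k ∈ Finset.range K, Ring.multichoose α k * t ^ k) := by
    have := hasSum_sum_of_ne_finset_zero (s := Finset.range K) (L := .unconditional ℕ)
      (f := fun k => if k ∈ Finset.range K then Ring.multichoose α k * t ^ k else 0)
      fun b hb => if_neg hb
    rwa [Finset.sum_congr rfl fun k hk => if_pos hk] at this
  -- Dropping the gaps with index below `K` leaves a multiple of the tail of the series of `B`.
  have e2 : (M - M₂) * (B - ∑ k ∈ Finset.range K, Ring.multichoose α k * t ^ k) ≤ M * B - A := by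
    refine hasSum_le (fun k => ?_) ((hB.sub hfin).mul_left (M - M₂)) hX
    split_ifs with hk
    · rw [sub_self, mul_zero]; exact hterm k
    · have := mul_le_mul_of_nonneg_right (h2 k (by simpa using hk)) (pow_nonneg ht0 k)
      linarith
  have e3 : ∑ k ∈ Finset.range K, Ring.multichoose α k * t ^ k ≤ S := by
    refine Finset.sum_le_sum fun k _ => ?_
    exact mul_le_of_le_one_right (multichoose_pos hα k).le (pow_le_one₀ ht0 ht1.le)
  -- The single gap `D` pays for the head of the series of `B`, which is at most `S`.
  have e4 : (M - M₂) * B ≤ (M * B - A) * (1 + (M - M₂) * S / D) := by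
    have h5 : (M - M₂) * S ≤ (M * B - A) * ((M - M₂) * S / D) := by
      calc (M - M₂) * S = D * ((M - M₂) * S / D) := by field_simp
        _ ≤ _ := by gcongr
    have h6 : (M - M₂) * (B - S) ≤
        (M - M₂) * (B - ∑ k ∈ Finset.range K, Ring.multichoose α k * t ^ k) := by gcongr
    linarith
  have e5 : c * B ≤ M * B - A := by
    rw [hc, div_mul_eq_mul_div, div_le_iff₀ hden]
    exact e4
  have ht' : 0 < 1 - t := by linarith
  calc (1 - t) ^ α * A ≤ (1 - t) ^ α * ((M - c) * B) := by
        gcongr; linarith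
    _ = M - c := by
      rw [hBdef, mul_left_comm, ← Real.rpow_add ht']; simp

end Series

/-! ### The ratios of coefficients -/

section Ratio

/-- The value of `∫ |x₁|²ᵏ⁺¹ (1 - |x|²)^α` over the unit ball of `ℂⁿ`. -/
def oddMoment (n : ℕ) (α : ℝ) (k : ℕ) : ℝ :=
  k.factorial * √Real.pi ^ (2 * n - 1) * Real.Gamma (α + 1) / Real.Gamma (k + α + n + 3 / 2)

variable {n : ℕ} {α : ℝ}

theorem oddMoment_pos (hα : -1 < α) (k : ℕ) : 0 < oddMoment n α k := by
  have h1 : 0 < Real.Gamma (α + 1) := Real.Gamma_pos_of_pos (by linarith)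
  have h2 : 0 < Real.Gamma (k + α + n + 3 / 2) :=
    Real.Gamma_pos_of_pos (by linarith [k.cast_nonneg (α := ℝ), n.cast_nonneg (α := ℝ)])
  unfold oddMoment
  positivity

theorem oddMoment_succ (hα : -1 < α) (k : ℕ) :
    oddMoment n α (k + 1) = oddMoment n α k * ((k + 1) / (k + α + n + 3 / 2)) := by
  have h1 : 0 < k + α + n + 3 / 2 := by linarith [k.cast_nonneg (α := ℝ), n.cast_nonneg (α := ℝ)]
  have h2 := (Real.Gamma_pos_of_pos h1).ne'
  rw [oddMoment, oddMoment, Nat.factorial_succ, Nat.cast_mul, Nat.cast_succ,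
    show (k + 1 : ℝ) + α + n + 3 / 2 = (k + α + n + 3 / 2) + 1 by ring, Real.Gamma_add_one h1.ne']
  field_simp

/-- The `k`-th coefficient of the power series that majorizes the norm of the gradient, divided by
the `k`-th coefficient of `(1 - t)^(-α)`. -/
def coeffRatio (n : ℕ) (α : ℝ) (k : ℕ) : ℝ :=
  Ring.multichoose (2 * α) (2 * k) * oddMoment n α k / Ring.multichoose α k

theorem coeffRatio_pos (hα : 0 < α) (k : ℕ) : 0 < coeffRatio n α k :=
  div_pos (mul_pos (multichoose_pos (by linarith) _) (oddMoment_pos (by linarith) k))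
    (multichoose_pos hα k)

theorem coeffRatio_mul (hα : 0 < α) (k : ℕ) :
    coeffRatio n α k * Ring.multichoose α k =
      Ring.multichoose (2 * α) (2 * k) * oddMoment n α k :=
  div_mul_cancel₀ _ (multichoose_pos hα k).ne'

theorem coeffRatio_zero : coeffRatio n α 0 = oddMoment n α 0 := by simp [coeffRatio]

theorem coeffRatio_succ (hα : 0 < α) (k : ℕ) :
    coeffRatio n α (k + 1) = coeffRatio n α k *
      ((2 * k + 2 * α + 1) * (k + 1) / ((2 * k + 1) * (k + α + n + 3 / 2))) := by
  have h1 := (multichoose_pos hα k).ne'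
  rw [coeffRatio, coeffRatio, oddMoment_succ (by linarith), multichoose_succ α,
    show 2 * (k + 1) = 2 * k + 1 + 1 by ring, multichoose_succ, multichoose_succ]
  push_cast
  have h2 : (k : ℝ) + α ≠ 0 := by positivity
  have h3 : (α : ℝ) + k ≠ 0 := by positivity
  have h4 : (2 * k + 1 : ℝ) ≠ 0 := by positivity
  have h5 : (2 * k + 1 + 1 : ℝ) ≠ 0 := by positivity
  have h6 : (k + α + n + 3 / 2 : ℝ) ≠ 0 := by positivity
  have h7 : (k + 1 : ℝ) ≠ 0 := by positivity
  field_simp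
  ring

/-- The ratios decrease exactly from the index `k'_α` on, which is how `k'_α` arises. -/
theorem coeffRatio_succ_le_iff (hα : 0 < α) (k : ℕ) :
    coeffRatio n α (k + 1) ≤ coeffRatio n α k ↔ α / (2 * n + 1) - 1 / 2 ≤ k := by
  have h1 := coeffRatio_pos (n := n) hα k
  have h2 : (0 : ℝ) < (2 * k + 1) * (k + α + n + 3 / 2) := by positivity
  have h3 : (0 : ℝ) < 2 * n + 1 := by positivity
  rw [coeffRatio_succ hα, mul_le_iff_le_one_right h1, div_le_one h2, sub_le_iff_le_add,
    div_le_iff₀ h3]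
  constructor <;> intro h <;> nlinarith

theorem coeffRatio_lt_succ_iff (hα : 0 < α) (k : ℕ) :
    coeffRatio n α k < coeffRatio n α (k + 1) ↔ (k : ℝ) < α / (2 * n + 1) - 1 / 2 := by
  rw [← not_le, coeffRatio_succ_le_iff hα, not_le]

theorem coeffRatio_succ_lt (hα : 0 < α) {k : ℕ} (hk : α / (2 * n + 1) - 1 / 2 < k) :
    coeffRatio n α (k + 1) < coeffRatio n α k := by
  have h1 := coeffRatio_pos (n := n) hα k
  have h2 : (0 : ℝ) < (2 * k + 1) * (k + α + n + 3 / 2) := by positivity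
  have h3 : (0 : ℝ) < 2 * n + 1 := by positivity
  rw [sub_lt_iff_lt_add, div_lt_iff₀ h3] at hk
  rw [coeffRatio_succ hα, mul_lt_iff_lt_one_right h1, div_lt_one h2]
  nlinarith

theorem coeffRatio_antitone (hα : 0 < α) {k l : ℕ} (hk : kPrime n α ≤ k) (hkl : k ≤ l) :
    coeffRatio n α l ≤ coeffRatio n α k := by
  induction l, hkl using Nat.le_induction with
  | base => exact le_rfl
  | succ m hm ih =>
    exact ((coeffRatio_succ_le_iff hα m).2 (Nat.ceil_le.1 (hk.trans hm))).trans ih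

theorem coeffRatio_monotone (hα : 0 < α) {k l : ℕ} (hl : l ≤ kPrime n α) (hkl : k ≤ l) :
    coeffRatio n α k ≤ coeffRatio n α l := by
  induction l, hkl using Nat.le_induction with
  | base => exact le_rfl
  | succ m hm ih =>
    exact (ih (by omega)).trans ((coeffRatio_lt_succ_iff hα m).2 (Nat.lt_ceil.1 hl)).le

theorem coeffRatio_le_kPrime (hα : 0 < α) (k : ℕ) :
    coeffRatio n α k ≤ coeffRatio n α (kPrime n α) := by
  rcases le_total k (kPrime n α) with h | h
  · exact coeffRatio_monotone hα le_rfl h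
  · exact coeffRatio_antitone hα le_rfl h

theorem coeffRatio_kPrime_add_two_lt (hα : 0 < α) :
    coeffRatio n α (kPrime n α + 2) < coeffRatio n α (kPrime n α) := by
  have h := Nat.le_ceil (α / (2 * n + 1) - 1 / 2)
  refine (coeffRatio_succ_lt hα ?_).trans_le (coeffRatio_antitone hα le_rfl (Nat.le_succ _))
  rw [Nat.cast_succ]
  exact h.trans_lt (lt_add_one _)

theorem kPrime_eq_zero (h : α ≤ n + 1 / 2) : kPrime n α = 0 := by
  have h3 : (0 : ℝ) < 2 * n + 1 := by positivity
  rw [kPrime, Nat.ceil_eq_zero, sub_nonpos, div_le_iff₀ h3]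
  linarith

theorem coeffRatio_zero_lt_kPrime (hα : 0 < α) (h : n + 1 / 2 < α) :
    coeffRatio n α 0 < coeffRatio n α (kPrime n α) := by
  have h3 : (0 : ℝ) < 2 * n + 1 := by positivity
  have h4 : 0 < α / (2 * n + 1) - 1 / 2 := by
    rw [sub_pos, lt_div_iff₀ h3]; linarith
  exact ((coeffRatio_lt_succ_iff hα 0).2 (by simpa using h4)).trans_le
    (coeffRatio_le_kPrime hα 1)

end Ratio

/-! ### The majorant of the gradient -/

section Majorant

variable {n : ℕ} {α : ℝ}

theorem one_sub_norm_sq_div_pos {z ζ : EuclideanSpace ℂ (Fin n)} (hz : z ∈ unitBall n)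
    (hζ : ζ ∈ unitBall n) : 0 < (1 - ‖z‖ ^ 2) / ‖1 - herm ζ z‖ ^ 2 := by
  have h1 := one_sub_norm_sq_pos hz
  have h2 := norm_pos_iff.2 (one_sub_herm_ne_zero hζ hz)
  positivity

/-- The Jacobian of `φ_z` cancels the kernel. -/
theorem kernel_moebius_mul {z ζ : EuclideanSpace ℂ (Fin n)} (hz : z ∈ unitBall n)
    (hζ : ζ ∈ unitBall n) :
    ((1 - ‖z‖ ^ 2) / ‖1 - herm ζ z‖ ^ 2) ^ (n + 1) * kernel z (moebius z ζ) = 1 := by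
  have h1 := norm_ne_zero_iff.2 (one_sub_herm_ne_zero hζ hz)
  have h2 := (one_sub_norm_sq_pos hz).ne'
  rw [kernel, norm_one_sub_herm_comm z, one_sub_herm_moebius hz hζ, norm_div, norm_pow,
    Complex.norm_real, Real.norm_of_nonneg (defect_pos hz).le, defect_sq hz, ← mul_pow]
  convert one_pow (n + 1) using 2
  field_simp

theorem logGrad_moebius {z ζ : EuclideanSpace ℂ (Fin n)} (hz : z ∈ unitBall n)
    (hζ : ζ ∈ unitBall n) :
    logGrad z (moebius z ζ) = -(1 - ‖z‖ ^ 2)⁻¹ • tangential z ζ := by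
  have h1 := one_sub_herm_ne_zero hζ hz
  have hs : (defect z : ℂ) ≠ 0 := by exact_mod_cast (defect_pos hz).ne'
  have h2 : ((defect z : ℂ) ^ 2 / (1 - herm ζ z))⁻¹ * (1 - herm ζ z)⁻¹ =
      ((defect z : ℂ) ^ 2)⁻¹ := by field_simp
  rw [logGrad, one_sub_herm_moebius hz hζ, moebius, ← defect_sq hz, smul_smul, h2,
    ← Complex.coe_smul, ← Complex.coe_smul]
  push_cast
  module

/-- The integral that majorizes `(1 - |z|²) ∂_h (B_α f)(z)`, up to a constant factor, after the
change of variables `w = φ_z(ζ)`. -/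
def majorant (α : ℝ) (z h : EuclideanSpace ℂ (Fin n)) : ℝ :=
  ∫ ζ, |inner ℝ h ζ| * ((1 - ‖z‖ ^ 2) * (1 - ‖ζ‖ ^ 2) / ‖1 - herm ζ z‖ ^ 2) ^ α ∂(ballVolume n)

/-- The absolute value of the directional derivative of the kernel, integrated: the Berezin
kernel disappears under `w = φ_z(ζ)`, and `h` is replaced by a vector of no larger norm. -/
theorem integral_kernel_mul_abs_inner_logGrad {z : EuclideanSpace ℂ (Fin n)} (hz : z ∈ unitBall n)
    (α : ℝ) (h : EuclideanSpace ℂ (Fin n)) :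
    (1 - ‖z‖ ^ 2) * ∫ w, kernel z w * |inner ℝ (logGrad z w) h| * (1 - ‖w‖ ^ 2) ^ α
      ∂(ballVolume n) = majorant α z (tangential z h) := by
  rw [integral_ballVolume_comp_moebius hz, ← integral_const_mul, majorant]
  refine setIntegral_congr_fun measurableSet_unitBall fun ζ hζ => ?_
  have h1 := one_sub_norm_sq_pos hz
  rw [one_sub_norm_moebius_sq hz hζ, mul_assoc (kernel _ _), ← mul_assoc _ (kernel _ _),
    kernel_moebius_mul hz hζ, logGrad_moebius hz hζ, real_inner_smul_left, abs_mul, abs_neg,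
    abs_inv, abs_of_pos h1, one_mul, ← mul_assoc, mul_inv_cancel_left₀ h1.ne', real_inner_comm,
    real_inner_eq_re_herm, ← herm_tangential_comm, ← real_inner_eq_re_herm]

theorem normConst_pos (hα : -1 < α) : 0 < normConst n α := by
  have h1 : 0 < Real.Gamma (α + 1) := Real.Gamma_pos_of_pos (by linarith)
  have h2 : 0 < Real.Gamma (α + n + 1) :=
    Real.Gamma_pos_of_pos (by linarith [n.cast_nonneg (α := ℝ)])
  have := Real.pi_pos
  unfold normConst
  positivity

/-- A bound for real powers on a compact interval that needs no case distinction on the sign of the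
exponent. -/
theorem rpow_le_add_rpow {a b x : ℝ} (ha : 0 < a) (hax : a ≤ x) (hxb : x ≤ b) (α : ℝ) :
    x ^ α ≤ a ^ α + b ^ α := by
  have hx := ha.trans_le hax
  rcases le_total 0 α with h | h
  · have := Real.rpow_le_rpow hx.le hxb h
    have := Real.rpow_nonneg ha.le α
    linarith
  · have := Real.rpow_le_rpow_of_nonpos ha hax h
    have := Real.rpow_nonneg (hx.le.trans hxb) α
    linarith

theorem abs_inner_le_of_mem {ζ : EuclideanSpace ℂ (Fin n)} (hζ : ζ ∈ unitBall n)
    (h : EuclideanSpace ℂ (Fin n)) : |inner ℝ h ζ| ≤ ‖h‖ := by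
  have := abs_real_inner_le_norm h ζ
  have := mem_unitBall.1 hζ
  nlinarith [norm_nonneg h]

theorem mem_unitLinfty {f : EuclideanSpace ℂ (Fin n) → ℝ}
    (hf : AEStronglyMeasurable f (ballVolume n)) (h : ∀ w, |f w| ≤ 1) : f ∈ unitLinfty n := by
  have h1 : eLpNorm f ∞ (ballVolume n) ≤ 1 := by
    rw [eLpNorm_exponent_top]
    refine eLpNormEssSup_le_of_ae_enorm_bound (.of_forall fun w => ?_)
    rw [← ofReal_norm, Real.norm_eq_abs]
    simpa using h w
  exact ⟨⟨hf, h1.trans_lt ENNReal.one_lt_top⟩, h1⟩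

theorem ae_abs_le_one {f : EuclideanSpace ℂ (Fin n) → ℝ} (hf : f ∈ unitLinfty n) :
    ∀ᵐ w ∂(ballVolume n), |f w| ≤ 1 := by
  filter_upwards [ae_le_eLpNormEssSup (f := f) (μ := ballVolume n)] with w hw
  rw [← eLpNorm_exponent_top] at hw
  have := hw.trans hf.2
  rw [← ofReal_norm, Real.norm_eq_abs] at this
  simpa using this

theorem norm_gradient (u : EuclideanSpace ℂ (Fin n) → ℝ) (z : EuclideanSpace ℂ (Fin n)) :
    ‖gradient u z‖ = ‖fderiv ℝ u z‖ := LinearIsometryEquiv.norm_map _ _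

theorem integral_abs_inner_pow_mul_weight (hα : -1 < α) {e : EuclideanSpace ℂ (Fin n)}
    (he : ‖e‖ = 1) (k : ℕ) :
    ∫ ζ, |inner ℝ e ζ| ^ (2 * k + 1) * (1 - ‖ζ‖ ^ 2) ^ α ∂(ballVolume n) = oddMoment n α k := by
  have h1 := setIntegral_abs_inner_pow_mul_weight he (2 * k + 1) hα
  have h2 : Module.finrank ℝ (EuclideanSpace ℂ (Fin n)) = 2 * n := by
    rw [finrank_real_of_complex, finrank_euclideanSpace_fin]
  rw [h2] at h1
  rw [ballVolume, unitBall, h1, oddMoment]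
  have h3 : (((2 * k + 1 : ℕ) : ℝ) + 1) / 2 = k + 1 := by push_cast; ring
  have h4 : (((2 * n : ℕ) : ℝ) + ((2 * k + 1 : ℕ) : ℝ)) / 2 + α + 1 = k + α + n + 3 / 2 := by
    push_cast; ring
  rw [h3, h4, Real.Gamma_nat_eq_factorial]

theorem integral_abs_re_mul_weight (hα : -1 < α) (i : Fin n) :
    ∫ w : EuclideanSpace ℂ (Fin n), |(w i).re| * (1 - ‖w‖ ^ 2) ^ α ∂(ballVolume n) =
      oddMoment n α 0 := by
  rw [← integral_abs_inner_pow_mul_weight hα (e := EuclideanSpace.single i 1) (by simp)]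
  refine integral_congr_ae (.of_forall fun w => ?_)
  simp only [mul_zero, zero_add, pow_one]
  rw [real_inner_comm, real_inner_eq_re_herm, herm, EuclideanSpace.inner_single_left]
  simp

/-- A polar decomposition that also covers `v = 0`. -/
theorem exists_unit_smul [NeZero n] (v : EuclideanSpace ℂ (Fin n)) :
    ∃ e : EuclideanSpace ℂ (Fin n), ‖e‖ = 1 ∧ v = ‖v‖ • e := by
  by_cases hv : v = 0
  · obtain ⟨e, he⟩ := exists_norm_eq (EuclideanSpace ℂ (Fin n)) zero_le_one
    exact ⟨e, he, by simp [hv]⟩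
  · refine ⟨‖v‖⁻¹ • v, ?_, ?_⟩
    · rw [norm_smul, norm_inv, norm_norm, inv_mul_cancel₀ (norm_ne_zero_iff.2 hv)]
    · rw [smul_inv_smul₀ (norm_ne_zero_iff.2 hv)]

variable [NeZero n]

theorem integrable_mul_weight (hα : -1 < α) {g : EuclideanSpace ℂ (Fin n) → ℝ}
    (hg : AEStronglyMeasurable g (ballVolume n)) {C : ℝ} (hC : ∀ x ∈ unitBall n, |g x| ≤ C) :
    Integrable (fun x => g x * (1 - ‖x‖ ^ 2) ^ α) (ballVolume n) :=
  integrableOn_mul_weight hα hg hC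

theorem integrable_abs_inner_pow_mul_weight (hα : -1 < α) (h : EuclideanSpace ℂ (Fin n)) (p : ℕ) :
    Integrable (fun ζ => |inner ℝ h ζ| ^ p * (1 - ‖ζ‖ ^ 2) ^ α) (ballVolume n) := by
  refine integrable_mul_weight hα (C := ‖h‖ ^ p) ?_ fun ζ hζ => ?_
  · exact Continuous.aestronglyMeasurable (by fun_prop)
  · rw [abs_pow, abs_abs]
    have := abs_inner_le_of_mem hζ h
    gcongr

theorem integral_abs_inner_pow_mul_weight_le (hα : -1 < α) {h : EuclideanSpace ℂ (Fin n)}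
    (hh : ‖h‖ ≤ 1) (k : ℕ) :
    ∫ ζ, |inner ℝ h ζ| ^ (2 * k + 1) * (1 - ‖ζ‖ ^ 2) ^ α ∂(ballVolume n) ≤ oddMoment n α k := by
  obtain ⟨e, he, hhe⟩ := exists_unit_smul h
  rw [← integral_abs_inner_pow_mul_weight hα he k]
  refine setIntegral_mono_on (integrable_abs_inner_pow_mul_weight hα h _)
    (integrable_abs_inner_pow_mul_weight hα e _) measurableSet_unitBall fun ζ hζ => ?_
  have := (weight_pos hζ α).le
  have : |inner ℝ h ζ| ≤ |inner ℝ e ζ| := by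
    rw [hhe, real_inner_smul_left, abs_mul, abs_norm]
    exact mul_le_of_le_one_left (abs_nonneg _) hh
  gcongr

/-- The weighted inequality of arithmetic and geometric means for `a^(m+1)` and `b^(m+1)`. -/
theorem mul_pow_le_weighted_sum {a b : ℝ} (ha : 0 ≤ a) (hb : 0 ≤ b) (m : ℕ) :
    (m + 1) * (a * b ^ m) ≤ a ^ (m + 1) + m * b ^ (m + 1) := by
  induction m with
  | zero => simp
  | succ m ih =>
    have h1 : 0 ≤ (b ^ (m + 1) - a ^ (m + 1)) * (b - a) := by
      rcases le_total a b with h | h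
      · exact mul_nonneg (sub_nonneg.2 (pow_le_pow_left₀ ha h _)) (sub_nonneg.2 h)
      · exact mul_nonneg_of_nonpos_of_nonpos (sub_nonpos.2 (pow_le_pow_left₀ hb h _))
          (sub_nonpos.2 h)
    have h2 := mul_le_mul_of_nonneg_right ih hb
    push_cast
    simp only [pow_succ] at *
    linarith

/-- Among products of one linear functional with the `2k`-th power of another, the integral is
largest when the two functionals coincide. -/
theorem integral_abs_inner_mul_pow_le (hα : -1 < α) {h : EuclideanSpace ℂ (Fin n)}
    (hh : ‖h‖ ≤ 1) (z : EuclideanSpace ℂ (Fin n)) (k : ℕ) :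
    ∫ ζ, |inner ℝ h ζ| * inner ℝ z ζ ^ (2 * k) * (1 - ‖ζ‖ ^ 2) ^ α ∂(ballVolume n) ≤
      oddMoment n α k * (‖z‖ ^ 2) ^ k := by
  obtain ⟨e, he, hze⟩ := exists_unit_smul z
  have h1 : ∫ ζ, |inner ℝ h ζ| * |inner ℝ e ζ| ^ (2 * k) * (1 - ‖ζ‖ ^ 2) ^ α ∂(ballVolume n) ≤
      oddMoment n α k := by
    have hi1 := integrable_abs_inner_pow_mul_weight hα h (2 * k + 1)
    have hi2 := integrable_abs_inner_pow_mul_weight hα e (2 * k + 1)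
    have hi3 : Integrable (fun ζ => |inner ℝ h ζ| * |inner ℝ e ζ| ^ (2 * k) * (1 - ‖ζ‖ ^ 2) ^ α)
        (ballVolume n) := by
      refine integrable_mul_weight hα (C := ‖h‖ * ‖e‖ ^ (2 * k))
        (Continuous.aestronglyMeasurable (by fun_prop)) fun ζ hζ => ?_
      have := abs_inner_le_of_mem hζ h
      have := abs_inner_le_of_mem hζ e
      rw [abs_mul, abs_pow, abs_abs, abs_abs]
      gcongr
    have hle : (2 * k + 1 : ℝ) *
        ∫ ζ, |inner ℝ h ζ| * |inner ℝ e ζ| ^ (2 * k) * (1 - ‖ζ‖ ^ 2) ^ α ∂(ballVolume n) ≤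
        ∫ ζ, |inner ℝ h ζ| ^ (2 * k + 1) * (1 - ‖ζ‖ ^ 2) ^ α ∂(ballVolume n) +
        2 * k * ∫ ζ, |inner ℝ e ζ| ^ (2 * k + 1) * (1 - ‖ζ‖ ^ 2) ^ α ∂(ballVolume n) := by
      rw [← integral_const_mul, ← integral_const_mul, ← integral_add hi1 (hi2.const_mul _)]
      refine setIntegral_mono_on (hi3.const_mul _) (hi1.add (hi2.const_mul _))
        measurableSet_unitBall fun ζ hζ => ?_
      have h3 := mul_le_mul_of_nonneg_right (mul_pow_le_weighted_sum (abs_nonneg (inner ℝ h ζ))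
        (abs_nonneg (inner ℝ e ζ)) (2 * k)) (weight_pos hζ α).le
      push_cast at h3
      linarith
    rw [integral_abs_inner_pow_mul_weight hα he] at hle
    have := integral_abs_inner_pow_mul_weight_le hα hh k
    have hk : (0 : ℝ) < 2 * k + 1 := by positivity
    refine le_of_mul_le_mul_left ?_ hk
    linarith
  have h2 : ∀ ζ, |inner ℝ h ζ| * inner ℝ z ζ ^ (2 * k) * (1 - ‖ζ‖ ^ 2) ^ α =
      (‖z‖ ^ 2) ^ k * (|inner ℝ h ζ| * |inner ℝ e ζ| ^ (2 * k) * (1 - ‖ζ‖ ^ 2) ^ α) := by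
    intro ζ
    have : inner ℝ z ζ = ‖z‖ * inner ℝ e ζ := by
      conv_lhs => rw [hze, real_inner_smul_left]
    rw [this, mul_pow, pow_mul, (even_two_mul k).pow_abs]
    ring
  simp only [h2]
  rw [integral_const_mul, mul_comm]
  gcongr

theorem integrable_majorant (hα : -1 < α) {z : EuclideanSpace ℂ (Fin n)} (hz : z ∈ unitBall n)
    (h : EuclideanSpace ℂ (Fin n)) :
    Integrable (fun ζ => |inner ℝ h ζ| *
      ((1 - ‖z‖ ^ 2) * (1 - ‖ζ‖ ^ 2) / ‖1 - herm ζ z‖ ^ 2) ^ α) (ballVolume n) := by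
  have h0 := one_sub_norm_sq_pos hz
  have hz' := mem_unitBall.1 hz
  have h3 : Integrable (fun ζ => |inner ℝ h ζ| * ((1 - ‖z‖ ^ 2) / ‖1 - herm ζ z‖ ^ 2) ^ α *
      (1 - ‖ζ‖ ^ 2) ^ α) (ballVolume n) := by
    refine integrable_mul_weight hα (C := ‖h‖ * (((1 - ‖z‖ ^ 2) / 2 ^ 2) ^ α +
      ((1 - ‖z‖ ^ 2) / (1 - ‖z‖) ^ 2) ^ α)) ?_ fun ζ hζ => ?_
    · have := (continuous_herm_left z).measurable
      exact Measurable.aestronglyMeasurable (by fun_prop)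
    · have h4 := one_sub_norm_sq_div_pos hz hζ
      have h5 := norm_pos_iff.2 (one_sub_herm_ne_zero hζ hz)
      rw [abs_mul, abs_abs, abs_of_nonneg (Real.rpow_nonneg h4.le α)]
      have := abs_inner_le_of_mem hζ h
      gcongr
      refine rpow_le_add_rpow (by positivity) ?_ ?_ α
      · gcongr
        have h6 := norm_sub_le 1 (herm ζ z)
        have h7 := norm_herm_le ζ z
        have h8 := mem_unitBall.1 hζ
        rw [norm_one] at h6
        nlinarith [norm_nonneg z, norm_nonneg ζ]
      · have h6 := one_sub_norm_le_norm_one_sub_herm (z := z) hζ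
        rw [norm_one_sub_herm_comm] at h6
        have : 0 < 1 - ‖z‖ := by linarith
        gcongr
  refine h3.congr (ae_ballVolume fun ζ hζ => ?_)
  simp only
  rw [mul_div_right_comm, Real.mul_rpow (one_sub_norm_sq_div_pos hz hζ).le
    (one_sub_norm_sq_pos hζ).le, mul_assoc]

/-- The even part of `(1 - Re ⟨ζ, z⟩)^(-2α)`, which bounds `|1 - ⟨ζ, z⟩|^(-2α)`, has a power series
with nonnegative coefficients. -/
theorem majorant_le_tsum (hα : 0 < α) {z h : EuclideanSpace ℂ (Fin n)} (hz : z ∈ unitBall n)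
    (hh : ‖h‖ ≤ 1) :
    majorant α z h ≤ (1 - ‖z‖ ^ 2) ^ α *
      ∑' k, coeffRatio n α k * Ring.multichoose α k * (‖z‖ ^ 2) ^ k := by
  have hα1 : -1 < α := by linarith
  have hz' := mem_unitBall.1 hz
  have h0 := one_sub_norm_sq_pos hz
  have hx (ζ : EuclideanSpace ℂ (Fin n)) (hζ : ζ ∈ unitBall n) : |inner ℝ z ζ| < 1 :=
    (abs_inner_le_of_mem hζ z).trans_lt hz'
  have hpow (v : EuclideanSpace ℂ (Fin n)) (hv : ‖v‖ < 1) : Integrable (fun ζ => |inner ℝ h ζ| *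
      (1 - inner ℝ v ζ) ^ (-(2 * α)) * (1 - ‖ζ‖ ^ 2) ^ α) (ballVolume n) := by
    refine integrable_mul_weight hα1 (C := ‖h‖ * (1 - ‖v‖) ^ (-(2 * α)))
      (Measurable.aestronglyMeasurable (by fun_prop)) fun ζ hζ => ?_
    have h1 := abs_inner_le_of_mem hζ h
    have h2 := (le_abs_self _).trans (abs_inner_le_of_mem hζ v)
    rw [abs_mul, abs_abs, abs_of_nonneg (Real.rpow_nonneg (by linarith) _)]
    have := Real.rpow_le_rpow_of_nonpos (x := 1 - ‖v‖) (y := 1 - inner ℝ v ζ) (z := -(2 * α))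
      (by linarith) (by linarith) (by linarith)
    have := Real.rpow_nonneg (show 0 ≤ 1 - inner ℝ v ζ by linarith) (-(2 * α))
    gcongr
  have e1 : majorant α z h ≤ (1 - ‖z‖ ^ 2) ^ α * ∫ ζ, |inner ℝ h ζ| *
      (1 - inner ℝ z ζ) ^ (-(2 * α)) * (1 - ‖ζ‖ ^ 2) ^ α ∂(ballVolume n) := by
    rw [← integral_const_mul]
    refine setIntegral_mono_on (integrable_majorant hα1 hz h) ((hpow z hz').const_mul _)
      measurableSet_unitBall fun ζ hζ => ?_
    have h1 := norm_pos_iff.2 (one_sub_herm_ne_zero hζ hz)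
    have h2 : 1 - inner ℝ z ζ ≤ ‖1 - herm ζ z‖ := by
      have := Complex.re_le_norm (1 - herm ζ z)
      rwa [Complex.sub_re, Complex.one_re, ← real_inner_eq_re_herm, real_inner_comm] at this
    have h3 : 0 < 1 - inner ℝ z ζ := by linarith [le_abs_self (inner ℝ z ζ), hx ζ hζ]
    have h4 := one_sub_norm_sq_pos hζ
    have h5 : (‖1 - herm ζ z‖ ^ 2) ^ (-α) ≤ (1 - inner ℝ z ζ) ^ (-(2 * α)) := by
      rw [← Real.rpow_natCast, ← Real.rpow_mul h1.le]
      push_cast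
      rw [mul_neg]
      exact Real.rpow_le_rpow_of_nonpos h3 h2 (by linarith)
    rw [Real.div_rpow (by positivity) (by positivity), Real.mul_rpow h0.le h4.le, div_eq_mul_inv,
      ← Real.rpow_neg (by positivity)]
    calc |inner ℝ h ζ| * ((1 - ‖z‖ ^ 2) ^ α * (1 - ‖ζ‖ ^ 2) ^ α * (‖1 - herm ζ z‖ ^ 2) ^ (-α))
        ≤ |inner ℝ h ζ| * ((1 - ‖z‖ ^ 2) ^ α * (1 - ‖ζ‖ ^ 2) ^ α *
          (1 - inner ℝ z ζ) ^ (-(2 * α))) := by gcongr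
      _ = _ := by ring
  refine e1.trans ?_
  gcongr
  -- The substitution `ζ ↦ -ζ` leaves only the even part of the series.
  have e2 : ∫ ζ, |inner ℝ h ζ| * (1 - inner ℝ z ζ) ^ (-(2 * α)) * (1 - ‖ζ‖ ^ 2) ^ α
      ∂(ballVolume n) = ∫ ζ, |inner ℝ h ζ| * (1 - inner ℝ (-z) ζ) ^ (-(2 * α)) *
        (1 - ‖ζ‖ ^ 2) ^ α ∂(ballVolume n) := by
    rw [ballVolume, ← integral_indicator measurableSet_unitBall,
      ← integral_indicator measurableSet_unitBall, ← integral_neg_eq_self]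
    refine integral_congr_ae (.of_forall fun ζ => ?_)
    simp [indicator, mem_unitBall]
  have e3 : ∫ ζ, |inner ℝ h ζ| * (1 - inner ℝ z ζ) ^ (-(2 * α)) * (1 - ‖ζ‖ ^ 2) ^ α
      ∂(ballVolume n) = ∫ ζ, (∑' k : ℕ, Ring.multichoose (2 * α) (2 * k) *
        (|inner ℝ h ζ| * inner ℝ z ζ ^ (2 * k) * (1 - ‖ζ‖ ^ 2) ^ α)) ∂(ballVolume n) := by
    have h1 := integral_add (hpow z hz') (hpow (-z) (by simpa using hz'))
    rw [← e2] at h1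
    have h2 := congrArg (fun x => x / 2) h1
    simp only [add_self_div_two] at h2
    rw [← h2, ← integral_div]
    refine setIntegral_congr_fun measurableSet_unitBall fun ζ hζ => ?_
    have h3 := ((hasSum_multichoose_even (hx ζ hζ) (2 * α)).mul_left
      (|inner ℝ h ζ| * (1 - ‖ζ‖ ^ 2) ^ α)).tsum_eq
    simp only [inner_neg_left, sub_neg_eq_add]
    rw [show (|inner ℝ h ζ| * (1 - inner ℝ z ζ) ^ (-(2 * α)) * (1 - ‖ζ‖ ^ 2) ^ α +
      |inner ℝ h ζ| * (1 + inner ℝ z ζ) ^ (-(2 * α)) * (1 - ‖ζ‖ ^ 2) ^ α) / 2 =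
      |inner ℝ h ζ| * (1 - ‖ζ‖ ^ 2) ^ α *
        (((1 - inner ℝ z ζ) ^ (-(2 * α)) + (1 + inner ℝ z ζ) ^ (-(2 * α))) / 2) by ring, ← h3]
    refine tsum_congr fun k => ?_
    ring
  have hint (k : ℕ) : Integrable (fun ζ => |inner ℝ h ζ| * inner ℝ z ζ ^ (2 * k) *
      (1 - ‖ζ‖ ^ 2) ^ α) (ballVolume n) := by
    refine integrable_mul_weight hα1 (C := ‖h‖ * ‖z‖ ^ (2 * k))
      (Continuous.aestronglyMeasurable (by fun_prop)) fun ζ hζ => ?_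
    have := abs_inner_le_of_mem hζ h
    have := abs_inner_le_of_mem hζ z
    rw [abs_mul, abs_pow, abs_abs]
    gcongr
  have hA (k : ℕ) : 0 ≤ Ring.multichoose (2 * α) (2 * k) := (multichoose_pos (by linarith) _).le
  have hnorm (k : ℕ) : ∫ ζ, ‖Ring.multichoose (2 * α) (2 * k) * (|inner ℝ h ζ| *
      inner ℝ z ζ ^ (2 * k) * (1 - ‖ζ‖ ^ 2) ^ α)‖ ∂(ballVolume n) =
      ∫ ζ, Ring.multichoose (2 * α) (2 * k) * (|inner ℝ h ζ| *
      inner ℝ z ζ ^ (2 * k) * (1 - ‖ζ‖ ^ 2) ^ α) ∂(ballVolume n) := by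
    refine setIntegral_congr_fun measurableSet_unitBall fun ζ hζ => ?_
    refine Real.norm_of_nonneg (mul_nonneg (hA k) (mul_nonneg (mul_nonneg (abs_nonneg _) ?_)
      (weight_pos hζ α).le))
    exact (even_two_mul k).pow_nonneg _
  have hterm (k : ℕ) : ∫ ζ, Ring.multichoose (2 * α) (2 * k) * (|inner ℝ h ζ| *
      inner ℝ z ζ ^ (2 * k) * (1 - ‖ζ‖ ^ 2) ^ α) ∂(ballVolume n) ≤
      coeffRatio n α k * Ring.multichoose α k * (‖z‖ ^ 2) ^ k := by
    rw [integral_const_mul, coeffRatio_mul hα, mul_assoc]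
    exact mul_le_mul_of_nonneg_left (integral_abs_inner_mul_pow_le hα1 hh z k) (hA k)
  have hsum : Summable fun k => coeffRatio n α k * Ring.multichoose α k * (‖z‖ ^ 2) ^ k := by
    have hB := hasSum_multichoose (x := ‖z‖ ^ 2)
      (by rw [abs_of_nonneg (by positivity)]; linarith) α
    refine Summable.of_nonneg_of_le (fun k => ?_) (fun k => ?_)
      (hB.summable.mul_left (coeffRatio n α (kPrime n α)))
    · have := coeffRatio_pos (n := n) hα k
      have := multichoose_pos hα k
      positivity
    · rw [← mul_assoc]
      have := coeffRatio_le_kPrime (n := n) hα k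
      have := multichoose_pos hα k
      gcongr
  rw [e3, ← (hasSum_integral_of_summable_integral_norm (fun k => (hint k).const_mul _) ?_).tsum_eq]
  · refine Summable.tsum_le_tsum hterm ?_ hsum
    refine Summable.of_nonneg_of_le (fun k => ?_) hterm hsum
    rw [← hnorm]
    exact integral_nonneg fun _ => norm_nonneg _
  · refine Summable.of_nonneg_of_le (fun k => integral_nonneg fun _ => norm_nonneg _)
      (fun k => ?_) hsum
    rw [hnorm]
    exact hterm k

theorem abs_fderiv_berezin_le (hα : -1 < α) {f : EuclideanSpace ℂ (Fin n) → ℝ}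
    (hf : f ∈ unitLinfty n) {z : EuclideanSpace ℂ (Fin n)} (hz : z ∈ unitBall n)
    (h : EuclideanSpace ℂ (Fin n)) :
    (1 - ‖z‖ ^ 2) * |fderiv ℝ (berezin n α f) z h| ≤
      2 * normConst n α * (n + 1) * majorant α z (tangential z h) := by
  have h0 := one_sub_norm_sq_pos hz
  have hc := normConst_pos (n := n) hα
  have hz' := mem_unitBall.1 hz
  rw [fderiv_berezin hα hf.1 hz, abs_mul, abs_of_pos (by positivity), mul_left_comm,
    ← integral_kernel_mul_abs_inner_logGrad hz]
  gcongr
  refine abs_integral_le_integral_abs.trans ?_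
  refine integral_mono_of_nonneg (.of_forall fun _ => abs_nonneg _) ?_ ?_
  · refine integrable_mul_weight hα
      (C := (1 / (1 - ‖z‖) ^ 2) ^ (n + 1) * (2 / (1 - ‖z‖) * ‖h‖)) ?_ fun w hw => ?_
    · have h1 := measurable_kernel z
      have h2 := measurable_logGrad z
      exact Measurable.aestronglyMeasurable (by fun_prop)
    · rw [abs_mul, abs_abs, abs_of_pos (kernel_pos hz hw)]
      have h1 := kernel_le hz' le_rfl hw
      have h2 := norm_logGrad_le hz' le_rfl hw
      have h3 := abs_real_inner_le_norm (logGrad z w) h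
      gcongr
      exact h3.trans (by gcongr)
  · filter_upwards [ae_mem_unitBall, ae_abs_le_one hf] with w hw hfw
    have h1 := (kernel_pos hz hw).le
    have h2 := (weight_pos hw α).le
    rw [abs_mul, abs_mul, abs_mul, abs_of_nonneg h1, abs_of_nonneg h2]
    calc kernel z w * |f w| * (1 - ‖w‖ ^ 2) ^ α * |inner ℝ (logGrad z w) h|
        ≤ kernel z w * 1 * (1 - ‖w‖ ^ 2) ^ α * |inner ℝ (logGrad z w) h| := by gcongr
      _ = _ := by ring

theorem norm_gradient_berezin_le (hα : -1 < α) {f : EuclideanSpace ℂ (Fin n) → ℝ}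
    (hf : f ∈ unitLinfty n) {z : EuclideanSpace ℂ (Fin n)} (hz : z ∈ unitBall n) {K : ℝ}
    (hK0 : 0 ≤ K) (hK : ∀ h : EuclideanSpace ℂ (Fin n), ‖h‖ ≤ 1 → majorant α z h ≤ K) :
    (1 - ‖z‖ ^ 2) * ‖gradient (berezin n α f) z‖ ≤ 2 * normConst n α * (n + 1) * K := by
  have h0 := one_sub_norm_sq_pos hz
  have hc := normConst_pos (n := n) hα
  rw [norm_gradient, ← le_div_iff₀' h0]
  refine ContinuousLinearMap.opNorm_le_of_unit_norm (by positivity) fun h hh => ?_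
  rw [le_div_iff₀' h0, Real.norm_eq_abs]
  refine (abs_fderiv_berezin_le hα hf hz h).trans ?_
  have := hK _ ((norm_tangential_le hz h).trans hh.le)
  gcongr

end Majorant

/-! ### Bounds for the majorant -/

section Bounds

variable {n : ℕ} [NeZero n] {α : ℝ}

theorem majorant_le_oddMoment (hα : 0 ≤ α) (hαn : α ≤ n + 1 / 2) {z h : EuclideanSpace ℂ (Fin n)}
    (hz : z ∈ unitBall n) (hh : ‖h‖ ≤ 1) : majorant α z h ≤ oddMoment n α 0 := by
  rcases hα.eq_or_lt with rfl | hα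
  · simpa [majorant] using integral_abs_inner_pow_mul_weight_le (α := 0) (by norm_num) hh 0
  have h0 := one_sub_norm_sq_pos hz
  refine (majorant_le_tsum hα hz hh).trans ?_
  have hB := hasSum_multichoose (x := ‖z‖ ^ 2)
    (by rw [abs_of_nonneg (by positivity)]; linarith) α
  have hle (k : ℕ) : coeffRatio n α k * Ring.multichoose α k * (‖z‖ ^ 2) ^ k ≤
      oddMoment n α 0 * (Ring.multichoose α k * (‖z‖ ^ 2) ^ k) := by
    have h1 := coeffRatio_le_kPrime (n := n) hα k
    rw [kPrime_eq_zero hαn, coeffRatio_zero] at h1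
    have := multichoose_pos hα k
    rw [mul_assoc]
    gcongr
  have hsum := hB.mul_left (oddMoment n α 0)
  have hs : Summable fun k => coeffRatio n α k * Ring.multichoose α k * (‖z‖ ^ 2) ^ k := by
    refine Summable.of_nonneg_of_le (fun k => ?_) hle hsum.summable
    have := coeffRatio_pos (n := n) hα k
    have := multichoose_pos hα k
    positivity
  have h2 := hasSum_le hle hs.hasSum hsum
  calc (1 - ‖z‖ ^ 2) ^ α * ∑' k, coeffRatio n α k * Ring.multichoose α k * (‖z‖ ^ 2) ^ k
      ≤ (1 - ‖z‖ ^ 2) ^ α * (oddMoment n α 0 * (1 - ‖z‖ ^ 2) ^ (-α)) := by gcongr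
    _ = oddMoment n α 0 := by
      rw [mul_left_comm, ← Real.rpow_add h0]; simp

/-- A bound for the majorant below the largest ratio, uniform over `|z|² ≥ δ`. For `j = 0` the
choice `δ = 0` is allowed, because `0 ^ 0 = 1`. -/
theorem exists_majorant_le {j : ℕ} (hα : 0 < α)
    (hj : coeffRatio n α j < coeffRatio n α (kPrime n α)) {δ : ℝ} (hδ : 0 ≤ δ) (hδj : 0 < δ ^ j) :
    ∃ M, 0 ≤ M ∧ M < coeffRatio n α (kPrime n α) ∧ ∀ z ∈ unitBall n, δ ≤ ‖z‖ ^ 2 →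
      ∀ h : EuclideanSpace ℂ (Fin n), ‖h‖ ≤ 1 → majorant α z h ≤ M := by
  obtain ⟨M, hM, hle⟩ := exists_lt_mul_tsum_le hα
    (a := fun k => coeffRatio n α k * Ring.multichoose α k)
    (fun k => (mul_pos (coeffRatio_pos hα k) (multichoose_pos hα k)).le)
    (coeffRatio_kPrime_add_two_lt (n := n) hα) (K := kPrime n α + 2) (j := j)
    (fun k => mul_le_mul_of_nonneg_right (coeffRatio_le_kPrime hα k) (multichoose_pos hα k).le)
    (fun k hk => mul_le_mul_of_nonneg_right (coeffRatio_antitone hα (Nat.le_add_right _ _) hk)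
      (multichoose_pos hα k).le)
    (mul_lt_mul_of_pos_right hj (multichoose_pos hα j)) hδ hδj
  refine ⟨max M 0, le_max_right _ _, max_lt hM (coeffRatio_pos hα _), fun z hz hzδ h hh => ?_⟩
  exact ((majorant_le_tsum hα hz hh).trans
    (hle _ hzδ (by linarith [one_sub_norm_sq_pos hz]))).trans (le_max_left _ _)

end Bounds

/-! ### The gradient at the origin -/

section Origin

variable {n : ℕ} {α : ℝ}

theorem ofReal_le_blochSeminorm (u : EuclideanSpace ℂ (Fin n) → ℝ) {z : EuclideanSpace ℂ (Fin n)}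
    (hz : z ∈ unitBall n) :
    ENNReal.ofReal ((1 - ‖z‖ ^ 2) * ‖gradient u z‖) ≤ blochSeminorm u :=
  le_iSup₂ (f := fun z (_ : z ∈ unitBall n) =>
    ENNReal.ofReal ((1 - ‖z‖ ^ 2) * ‖gradient u z‖)) z hz

theorem zero_mem_unitBall : (0 : EuclideanSpace ℂ (Fin n)) ∈ unitBall n := by simp [mem_unitBall]

theorem ofReal_norm_gradient_zero_le_blochSeminorm (u : EuclideanSpace ℂ (Fin n) → ℝ) :
    ENNReal.ofReal ‖gradient u 0‖ ≤ blochSeminorm u := by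
  simpa using ofReal_le_blochSeminorm u zero_mem_unitBall

theorem blochSeminorm_le_opSeminorm {f : EuclideanSpace ℂ (Fin n) → ℝ} (hf : f ∈ unitLinfty n) :
    blochSeminorm (berezin n α f) ≤ opSeminorm n α :=
  le_iSup₂ (f := fun f (_ : f ∈ unitLinfty n) => blochSeminorm (berezin n α f)) f hf

/-- The sign function is written `|g| / g`, with the value `0` where `g` vanishes. -/
theorem abs_div_self_mem_unitLinfty {g : EuclideanSpace ℂ (Fin n) → ℝ} (hg : Measurable g) :
    (fun w => |g w| / g w) ∈ unitLinfty n := by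
  refine mem_unitLinfty (Measurable.aestronglyMeasurable (by fun_prop)) fun w => ?_
  rw [abs_div, abs_abs]
  exact div_self_le_one _

variable [NeZero n]

theorem fderiv_berezin_zero (hα : -1 < α) {f : EuclideanSpace ℂ (Fin n) → ℝ}
    (hf : f ∈ unitLinfty n) (h : EuclideanSpace ℂ (Fin n)) :
    fderiv ℝ (berezin n α f) 0 h = 2 * normConst n α * (n + 1) *
      ∫ w, f w * inner ℝ h w * (1 - ‖w‖ ^ 2) ^ α ∂(ballVolume n) := by
  rw [fderiv_berezin hα hf.1 zero_mem_unitBall]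
  congr 1
  refine integral_congr_ae (.of_forall fun w => ?_)
  have h1 : herm w 0 = 0 := inner_zero_left _
  have h2 : herm 0 w = 0 := inner_zero_right _
  simp only [kernel, logGrad, h1, h2, real_inner_comm w h]
  simp
  ring

theorem le_norm_gradient_zero_of_isExtremal (hα : -1 < α) {f : EuclideanSpace ℂ (Fin n) → ℝ}
    (hf : f ∈ unitLinfty n) (hext : IsExtremal f) :
    2 * normConst n α * (n + 1) * oddMoment n α 0 ≤ ‖gradient (berezin n α f) 0‖ := by
  obtain ⟨a, ha, hfa⟩ := hext
  have h1 : fderiv ℝ (berezin n α f) 0 a = 2 * normConst n α * (n + 1) * oddMoment n α 0 := by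
    rw [fderiv_berezin_zero hα hf, ← integral_abs_inner_pow_mul_weight hα ha]
    congr 1
    refine integral_congr_ae ?_
    filter_upwards [hfa] with w hw
    rw [hw, ← real_inner_eq_re_herm, real_inner_comm]
    rcases eq_or_ne (inner ℝ a w) 0 with h | h
    · simp [h]
    · rw [div_mul_cancel₀ _ h]; simp
  rw [← h1, norm_gradient]
  refine (le_abs_self _).trans ?_
  simpa [ha] using (fderiv ℝ (berezin n α f) 0).le_opNorm a

/-- Equality in `∫ f(w) Re ⟨w, a⟩ (1 - |w|²)^α ≤ ∫ |Re ⟨w, a⟩| (1 - |w|²)^α` for the direction `a`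
of the gradient determines `f` off the real hyperplane `Re ⟨w, a⟩ = 0`. -/
theorem isExtremal_of_le_norm_gradient_zero (hα : -1 < α) {f : EuclideanSpace ℂ (Fin n) → ℝ}
    (hf : f ∈ unitLinfty n)
    (hle : 2 * normConst n α * (n + 1) * oddMoment n α 0 ≤ ‖gradient (berezin n α f) 0‖) :
    IsExtremal f := by
  have hc := normConst_pos (n := n) hα
  have hκ : 0 < 2 * normConst n α * (n + 1) := by positivity
  obtain ⟨a, ha, hga⟩ := exists_unit_smul (gradient (berezin n α f) 0)
  have h1 : fderiv ℝ (berezin n α f) 0 a = ‖gradient (berezin n α f) 0‖ := by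
    have : inner ℝ (gradient (berezin n α f) 0) a = fderiv ℝ (berezin n α f) 0 a := by
      rw [gradient, InnerProductSpace.toDual_symm_apply]
    rw [← this]
    conv_lhs => rw [hga, real_inner_smul_left, real_inner_self_eq_norm_sq, ha]
    simp
  rw [← h1, fderiv_berezin_zero hα hf, mul_le_mul_iff_right₀ hκ,
    ← integral_abs_inner_pow_mul_weight hα ha] at hle
  have hi1 := integrable_abs_inner_pow_mul_weight hα a (2 * 0 + 1)
  have hi2 : Integrable (fun w => f w * inner ℝ a w * (1 - ‖w‖ ^ 2) ^ α) (ballVolume n) := by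
    refine hi1.mono' ((hf.1.1.mul (Continuous.aestronglyMeasurable (by fun_prop))).mul
      (aestronglyMeasurable_weight α)) ?_
    filter_upwards [ae_mem_unitBall, ae_abs_le_one hf] with w hw hfw
    rw [norm_mul, norm_mul, Real.norm_of_nonneg (weight_pos hw α).le, Real.norm_eq_abs,
      Real.norm_eq_abs]
    have := (weight_pos hw α).le
    simp only [mul_zero, zero_add, pow_one]
    gcongr
    exact mul_le_of_le_one_left (abs_nonneg _) hfw
  have hnn : 0 ≤ᵐ[ballVolume n] fun w => |inner ℝ a w| ^ (2 * 0 + 1) * (1 - ‖w‖ ^ 2) ^ α -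
      f w * inner ℝ a w * (1 - ‖w‖ ^ 2) ^ α := by
    filter_upwards [ae_mem_unitBall, ae_abs_le_one hf] with w hw hfw
    rw [← sub_mul]
    refine mul_nonneg (sub_nonneg.2 ?_) (weight_pos hw α).le
    simp only [mul_zero, zero_add, pow_one]
    refine (le_abs_self _).trans ?_
    rw [abs_mul]
    exact mul_le_of_le_one_left (abs_nonneg _) hfw
  have hzero : ∫ w, (|inner ℝ a w| ^ (2 * 0 + 1) * (1 - ‖w‖ ^ 2) ^ α -
      f w * inner ℝ a w * (1 - ‖w‖ ^ 2) ^ α) ∂(ballVolume n) = 0 := by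
    refine le_antisymm ?_ (integral_nonneg_of_ae hnn)
    rw [integral_sub hi1 hi2]
    linarith
  rw [integral_eq_zero_iff_of_nonneg_ae hnn (hi1.sub hi2)] at hzero
  have hker : ∀ᵐ w ∂(ballVolume n), inner ℝ a w ≠ 0 := by
    refine ae_restrict_of_ae ?_
    have h2 := Measure.addHaar_submodule (volume : Measure (EuclideanSpace ℂ (Fin n)))
      (LinearMap.ker (innerSL ℝ a : EuclideanSpace ℂ (Fin n) →ₗ[ℝ] ℝ)) (fun h => by
        have h3 : a ∈ LinearMap.ker (innerSL ℝ a : EuclideanSpace ℂ (Fin n) →ₗ[ℝ] ℝ) := by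
          rw [h]; trivial
        simp only [LinearMap.mem_ker, ContinuousLinearMap.coe_coe, innerSL_apply_apply] at h3
        rw [real_inner_self_eq_norm_sq, ha] at h3
        norm_num at h3)
    rw [measure_eq_zero_iff_ae_notMem] at h2
    filter_upwards [h2] with w hw
    simpa using hw
  refine ⟨a, ha, ?_⟩
  filter_upwards [hzero, hker, ae_mem_unitBall] with w h2 h3 hw
  rw [← real_inner_eq_re_herm, real_inner_comm, eq_div_iff h3]
  have h4 := (weight_pos hw α).ne'
  simp only [Pi.zero_apply, ← sub_mul, mul_eq_zero, h4, or_false, mul_zero, zero_add,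
    pow_one] at h2
  linarith

end Origin

/-! ### The operator seminorm -/

section Operator

variable {n : ℕ} [NeZero n] {α : ℝ}

theorem opSeminorm_le (hα : -1 < α) {K : ℝ} (hK0 : 0 ≤ K)
    (hK : ∀ z ∈ unitBall n, ∀ h : EuclideanSpace ℂ (Fin n), ‖h‖ ≤ 1 → majorant α z h ≤ K) :
    opSeminorm n α ≤ ENNReal.ofReal (2 * normConst n α * (n + 1) * K) :=
  iSup₂_le fun _ hf => iSup₂_le fun z hz =>
    ENNReal.ofReal_le_ofReal (norm_gradient_berezin_le hα hf hz hK0 (hK z hz))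

theorem exists_isExtremal : ∃ f ∈ unitLinfty n, IsExtremal f := by
  obtain ⟨a, ha⟩ := exists_norm_eq (EuclideanSpace ℂ (Fin n)) zero_le_one
  have := (continuous_herm_left a).measurable
  exact ⟨_, abs_div_self_mem_unitLinfty (g := fun w => (herm w a).re) (by fun_prop), a, ha,
    .rfl⟩

theorem opSeminorm_eq (hα : 0 ≤ α) (hαn : α ≤ n + 1 / 2) :
    opSeminorm n α = ENNReal.ofReal (2 * normConst n α * (n + 1) * oddMoment n α 0) := by
  have hα1 : -1 < α := by linarith
  refine le_antisymm (opSeminorm_le hα1 (oddMoment_pos hα1 0).le fun z hz h hh =>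
    majorant_le_oddMoment hα hαn hz hh) ?_
  obtain ⟨f, hf, hext⟩ := exists_isExtremal (n := n)
  exact (ENNReal.ofReal_le_ofReal (le_norm_gradient_zero_of_isExtremal hα1 hf hext)).trans
    ((ofReal_norm_gradient_zero_le_blochSeminorm _).trans (blochSeminorm_le_opSeminorm hf))

theorem isExtremal_iff_ofReal_norm_gradient_zero (hα : 0 ≤ α) (hαn : α ≤ n + 1 / 2)
    {f : EuclideanSpace ℂ (Fin n) → ℝ} (hf : f ∈ unitLinfty n) :
    ENNReal.ofReal ‖gradient (berezin n α f) 0‖ = opSeminorm n α ↔ IsExtremal f := by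
  have hα1 : -1 < α := by linarith
  constructor
  · intro h
    rw [opSeminorm_eq hα hαn] at h
    exact isExtremal_of_le_norm_gradient_zero hα1 hf
      ((ENNReal.ofReal_le_ofReal_iff (norm_nonneg _)).1 h.ge)
  · intro h
    refine le_antisymm ((ofReal_norm_gradient_zero_le_blochSeminorm _).trans
      (blochSeminorm_le_opSeminorm hf)) ?_
    rw [opSeminorm_eq hα hαn]
    exact ENNReal.ofReal_le_ofReal (le_norm_gradient_zero_of_isExtremal hα1 hf h)

/-- Away from the origin the majorant stays below its value there, so that the supremum is
attained on a compact ball, and there only at the origin. -/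
theorem isExtremal_of_blochSeminorm_eq (hα : 0 < α) (hαn : α ≤ n + 1 / 2)
    {f : EuclideanSpace ℂ (Fin n) → ℝ} (hf : f ∈ unitLinfty n)
    (h : blochSeminorm (berezin n α f) = opSeminorm n α) : IsExtremal f := by
  have hα1 : -1 < α := by linarith
  have hc := normConst_pos (n := n) hα1
  set κ := 2 * normConst n α * (n + 1) with hκ
  have hκ0 : 0 < κ := by positivity
  rw [opSeminorm_eq hα.le hαn, ← hκ] at h
  have hk0 := kPrime_eq_zero hαn
  have key (δ : ℝ) (hδ : 0 < δ) : ∃ M < oddMoment n α 0, ∀ z ∈ unitBall n, δ ≤ ‖z‖ ^ 2 →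
      (1 - ‖z‖ ^ 2) * ‖gradient (berezin n α f) z‖ ≤ κ * M := by
    have hj := coeffRatio_kPrime_add_two_lt (n := n) hα
    obtain ⟨M, hM0, hM, hle⟩ := exists_majorant_le hα hj hδ.le (pow_pos hδ _)
    rw [hk0, coeffRatio_zero] at hM
    exact ⟨M, hM, fun z hz hzδ => norm_gradient_berezin_le hα1 hf hz hM0 (hle z hz hzδ)⟩
  -- On `|z| ≥ 1/2` the values are bounded away from the supremum.
  obtain ⟨M, hM, hle⟩ := key (1 / 4) (by norm_num)
  have hsub : closedBall (0 : EuclideanSpace ℂ (Fin n)) (1 / 2) ⊆ unitBall n :=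
    closedBall_subset_ball (by norm_num)
  have hcont : ContinuousOn (fun z => (1 - ‖z‖ ^ 2) * ‖gradient (berezin n α f) z‖)
      (closedBall 0 (1 / 2)) := by
    simp only [norm_gradient]
    exact (Continuous.continuousOn (by fun_prop)).mul
      ((continuousOn_fderiv_berezin hα1 hf.1).mono hsub).norm
  obtain ⟨z₀, hz₀, hmax⟩ := (isCompact_closedBall (0 : EuclideanSpace ℂ (Fin n))
    (1 / 2)).exists_isMaxOn ⟨0, by simp⟩ hcont
  have hb : blochSeminorm (berezin n α f) ≤ ENNReal.ofReal
      (max ((1 - ‖z₀‖ ^ 2) * ‖gradient (berezin n α f) z₀‖) (κ * M)) := by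
    refine iSup₂_le fun z hz => ENNReal.ofReal_le_ofReal ?_
    rcases le_total ‖z‖ (1 / 2) with hz2 | hz2
    · exact (hmax (by simpa using hz2)).trans (le_max_left _ _)
    · exact (hle z hz (by nlinarith)).trans (le_max_right _ _)
  have h0 := one_sub_norm_sq_pos (hsub hz₀)
  rw [h, ENNReal.ofReal_le_ofReal_iff (le_max_of_le_left (by positivity)), le_max_iff] at hb
  have hMlt : κ * M < κ * oddMoment n α 0 := by gcongr
  have hz₀le := hb.resolve_right hMlt.not_ge
  have hz₀0 : z₀ = 0 := by
    by_contra hne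
    obtain ⟨M', hM', hle'⟩ := key (‖z₀‖ ^ 2) (by positivity)
    have h1 := hle' z₀ (hsub hz₀) le_rfl
    have h2 : κ * M' < κ * oddMoment n α 0 := by gcongr
    linarith
  rw [hz₀0] at hz₀le
  exact isExtremal_of_le_norm_gradient_zero hα1 hf (by simpa using hz₀le)

/-- Test at `z = r e` with `r² = 1 - s` and the sign function `f` for which the derivative at `z` in
direction `e` equals the majorant. The direction `e` is unchanged by the substitution,
because `tangential z` fixes `z`. -/
theorem le_opSeminorm_of_neg (hα : -1 < α) (hα0 : α < 0) {s : ℝ} (hs : 0 < s) (hs1 : s < 1) :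
    ENNReal.ofReal (2 * normConst n α * (n + 1) * (4 ^ α * oddMoment n (-α) 0) * s ^ α) ≤
      opSeminorm n α := by
  have hc := normConst_pos (n := n) hα
  obtain ⟨e, he⟩ := exists_norm_eq (EuclideanSpace ℂ (Fin n)) zero_le_one
  set r := √(1 - s) with hr
  have hr0 : 0 < r := Real.sqrt_pos.2 (by linarith)
  have hr2 : r ^ 2 = 1 - s := Real.sq_sqrt (by linarith)
  set z : EuclideanSpace ℂ (Fin n) := r • e with hzdef
  have hzn : ‖z‖ = r := by rw [hzdef, norm_smul, he, mul_one, Real.norm_of_nonneg hr0.le]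
  have hzs : 1 - ‖z‖ ^ 2 = s := by rw [hzn, hr2]; ring
  have hz : z ∈ unitBall n := by rw [mem_unitBall, hzn]; nlinarith
  have hte : tangential z e = e := by
    have h1 := tangential_self hz
    have h2 : tangential z (r • e) = r • tangential z e := by
      rw [← Complex.coe_smul, ← Complex.coe_smul, tangential, tangential, herm_smul_left]
      module
    rw [← hzdef, h1] at h2
    exact (smul_right_injective _ hr0.ne' (h2.symm.trans hzdef) :)
  have hmeas : Measurable fun w => inner ℝ (logGrad z w) e := by
    have := measurable_logGrad z
    fun_prop
  have hf := abs_div_self_mem_unitLinfty hmeas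
  set f := fun w => |inner ℝ (logGrad z w) e| / inner ℝ (logGrad z w) e with hfdef
  have hval : (1 - ‖z‖ ^ 2) * fderiv ℝ (berezin n α f) z e =
      2 * normConst n α * (n + 1) * majorant α z e := by
    have h1 := integral_kernel_mul_abs_inner_logGrad hz α e
    rw [hte] at h1
    rw [fderiv_berezin hα hf.1 hz, ← h1, mul_left_comm]
    congr 2
    refine integral_congr_ae (.of_forall fun w => ?_)
    simp only [hfdef]
    rcases eq_or_ne (inner ℝ (logGrad z w) e) 0 with h | h
    · simp [h]
    · field_simp
  have hmaj : s ^ α * (4 ^ α * oddMoment n (-α) 0) ≤ majorant α z e := by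
    rw [← integral_abs_inner_pow_mul_weight (by linarith) he, ← mul_assoc, ← integral_const_mul]
    refine setIntegral_mono_on ((integrable_abs_inner_pow_mul_weight (by linarith) e _).const_mul _)
      (integrable_majorant hα hz e) measurableSet_unitBall fun ζ hζ => ?_
    have h1 := one_sub_norm_sq_pos hζ
    have h2 := norm_pos_iff.2 (one_sub_herm_ne_zero hζ hz)
    have h3 : (1 - ‖ζ‖ ^ 2) / 2 ≤ ‖1 - herm ζ z‖ := by
      have := one_sub_norm_le_norm_one_sub_herm (z := ζ) hz
      have := mem_unitBall.1 hζ
      nlinarith [norm_nonneg ζ]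
    have h4 : s * (1 - ‖ζ‖ ^ 2) / ‖1 - herm ζ z‖ ^ 2 ≤ s * 4 * (1 - ‖ζ‖ ^ 2)⁻¹ := by
      calc s * (1 - ‖ζ‖ ^ 2) / ‖1 - herm ζ z‖ ^ 2
          ≤ s * (1 - ‖ζ‖ ^ 2) / ((1 - ‖ζ‖ ^ 2) / 2) ^ 2 := by gcongr
        _ = s * 4 * (1 - ‖ζ‖ ^ 2)⁻¹ := by field_simp; norm_num
    have h5 := Real.rpow_le_rpow_of_nonpos (by positivity) h4 hα0.le
    rw [Real.mul_rpow (by positivity) (by positivity), Real.mul_rpow hs.le (by norm_num),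
      Real.inv_rpow h1.le, ← Real.rpow_neg h1.le] at h5
    rw [hzs]
    simp only [mul_zero, zero_add, pow_one]
    calc s ^ α * 4 ^ α * (|inner ℝ e ζ| * (1 - ‖ζ‖ ^ 2) ^ (-α))
        = |inner ℝ e ζ| * (s ^ α * 4 ^ α * (1 - ‖ζ‖ ^ 2) ^ (-α)) := by ring
      _ ≤ _ := by gcongr
  refine le_trans (ENNReal.ofReal_le_ofReal ?_)
    ((ofReal_le_blochSeminorm (berezin n α f) hz).trans (blochSeminorm_le_opSeminorm hf))
  have h6 : fderiv ℝ (berezin n α f) z e ≤ ‖gradient (berezin n α f) z‖ := by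
    rw [norm_gradient]
    refine (le_abs_self _).trans ?_
    simpa [he] using (fderiv ℝ (berezin n α f) z).le_opNorm e
  calc 2 * normConst n α * (n + 1) * (4 ^ α * oddMoment n (-α) 0) * s ^ α
      = 2 * normConst n α * (n + 1) * (s ^ α * (4 ^ α * oddMoment n (-α) 0)) := by ring
    _ ≤ 2 * normConst n α * (n + 1) * majorant α z e := by gcongr
    _ = (1 - ‖z‖ ^ 2) * fderiv ℝ (berezin n α f) z e := hval.symm
    _ ≤ _ := by
      have := (one_sub_norm_sq_pos hz).le
      gcongr

theorem opSeminorm_eq_top (hα : -1 < α) (hα0 : α < 0) : opSeminorm n α = ∞ := by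
  have hc := normConst_pos (n := n) hα
  have hm := oddMoment_pos (n := n) (α := -α) (by linarith) 0
  have h1 : Filter.Tendsto (fun s : ℝ => ENNReal.ofReal
      (2 * normConst n α * (n + 1) * (4 ^ α * oddMoment n (-α) 0) * s ^ α))
      (nhdsWithin 0 (Ioi 0)) (nhds ∞) :=
    ENNReal.tendsto_ofReal_atTop.comp
      ((tendsto_rpow_neg_nhdsGT_zero hα0).const_mul_atTop (by positivity))
  refine top_le_iff.1 (le_of_tendsto h1 ?_)
  filter_upwards [Ioo_mem_nhdsGT (zero_lt_one (α := ℝ))] with s hs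
  exact le_opSeminorm_of_neg hα hα0 hs.1 hs.2

theorem opSeminorm_lt (hαn : n + 1 / 2 < α) :
    opSeminorm n α <
      ENNReal.ofReal (2 * normConst n α * (n + 1) * coeffRatio n α (kPrime n α)) := by
  have hα : 0 < α := lt_of_le_of_lt (by positivity) hαn
  have hα1 : -1 < α := by linarith
  have hc := normConst_pos (n := n) hα1
  obtain ⟨M, hM0, hM, hle⟩ := exists_majorant_le hα (coeffRatio_zero_lt_kPrime hα hαn)
    le_rfl (by norm_num : (0 : ℝ) < 0 ^ 0)
  refine (opSeminorm_le hα1 hM0 fun z hz h hh => hle z hz (by positivity) h hh).trans_lt ?_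
  have := coeffRatio_pos (n := n) hα (kPrime n α)
  refine (ENNReal.ofReal_lt_ofReal_iff (by positivity)).2 ?_
  gcongr

theorem normConst_mul_oddMoment (hα : -1 < α) (k : ℕ) :
    2 * normConst n α * (n + 1) * oddMoment n α k =
      2 / √Real.pi * (n + 1) *
        (k.factorial * Real.Gamma (α + n + 1) / Real.Gamma (k + α + n + 3 / 2)) := by
  have h1 := (Real.Gamma_pos_of_pos (show 0 < α + 1 by linarith)).ne'
  have hπ : √Real.pi ≠ 0 := (Real.sqrt_pos.2 Real.pi_pos).ne'
  have h2 : Real.pi ^ n = √Real.pi ^ (2 * n - 1) * √Real.pi := by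
    rw [← pow_succ, Nat.sub_add_cancel (by have := NeZero.pos n; omega), pow_mul,
      Real.sq_sqrt Real.pi_pos.le]
  rw [normConst, oddMoment, h2]
  field_simp

theorem normConst_mul_oddMoment_zero (hα : -1 < α) :
    2 * normConst n α * (n + 1) * oddMoment n α 0 =
      2 / Real.pi * (n + 1) * ProbabilityTheory.beta (α + n + 1) (1 / 2) := by
  have hπ : √Real.pi ≠ 0 := (Real.sqrt_pos.2 Real.pi_pos).ne'
  rw [normConst_mul_oddMoment hα, ProbabilityTheory.beta, Real.Gamma_one_half_eq,
    show α + n + 1 + 1 / 2 = α + n + 3 / 2 by ring]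
  simp only [Nat.factorial_zero, Nat.cast_one, one_mul, Nat.cast_zero, zero_add]
  have e : 2 / √Real.pi = 2 / Real.pi * √Real.pi := by
    rw [div_mul_eq_mul_div, div_eq_div_iff hπ Real.pi_ne_zero, mul_assoc,
      Real.mul_self_sqrt Real.pi_pos.le]
  rw [e]
  ring

end Operator

end BerezinBloch

end

theorem theorem2 (n : ℕ) (hn : 1 ≤ n) (α : ℝ) (hα : -1 < α) :
    -- every `B_α f` is of class `C¹` in the ball, so that its gradient makes sense
    (∀ f : EuclideanSpace ℂ (Fin n) → ℝ, MemLp f ∞ (BerezinBloch.ballVolume n) →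
      ContDiffOn ℝ 1 (BerezinBloch.berezin n α f) (BerezinBloch.unitBall n)) ∧
    -- (i)
    (0 ≤ α → α ≤ n + 1 / 2 →
      BerezinBloch.opSeminorm n α =
        ENNReal.ofReal (2 * BerezinBloch.normConst n α * (n + 1) *
          ∫ w, |(w ⟨0, hn⟩).re| * (1 - ‖w‖ ^ 2) ^ α ∂(BerezinBloch.ballVolume n)) ∧
      2 * BerezinBloch.normConst n α * (n + 1) *
          ∫ w, |(w ⟨0, hn⟩).re| * (1 - ‖w‖ ^ 2) ^ α ∂(BerezinBloch.ballVolume n) =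
        2 / Real.pi * (n + 1) * ProbabilityTheory.beta (α + n + 1) (1 / 2) ∧
      ∀ f ∈ BerezinBloch.unitLinfty n,
        (BerezinBloch.IsExtremal f →
          BerezinBloch.blochSeminorm (BerezinBloch.berezin n α f) =
            BerezinBloch.opSeminorm n α) ∧
        (0 < α →
          BerezinBloch.blochSeminorm (BerezinBloch.berezin n α f) =
            BerezinBloch.opSeminorm n α → BerezinBloch.IsExtremal f) ∧
        (ENNReal.ofReal ‖gradient (BerezinBloch.berezin n α f) 0‖ =
          BerezinBloch.opSeminorm n α ↔ BerezinBloch.IsExtremal f)) ∧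
    -- (ii)
    (α < 0 → BerezinBloch.opSeminorm n α = ∞) ∧
    -- (iii)
    (n + 1 / 2 < α →
      BerezinBloch.opSeminorm n α <
        ENNReal.ofReal (2 / √Real.pi * (n + 1) *
          Ring.choose (2 * (BerezinBloch.kPrime n α : ℝ) + 2 * α - 1)
            (2 * BerezinBloch.kPrime n α) *
          (Ring.choose ((BerezinBloch.kPrime n α : ℝ) + α - 1) (BerezinBloch.kPrime n α))⁻¹ *
          ((BerezinBloch.kPrime n α).factorial * Real.Gamma (α + n + 1) /
            Real.Gamma (BerezinBloch.kPrime n α + α + n + 3 / 2)))) := by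
  have : NeZero n := ⟨by omega⟩
  refine ⟨fun f hf => BerezinBloch.contDiffOn_berezin hα hf, fun hα0 hαn => ?_,
    BerezinBloch.opSeminorm_eq_top hα, fun hαn => ?_⟩
  · rw [BerezinBloch.integral_abs_re_mul_weight hα]
    refine ⟨BerezinBloch.opSeminorm_eq hα0 hαn, BerezinBloch.normConst_mul_oddMoment_zero hα,
      fun f hf => ?_⟩
    have hiff := BerezinBloch.isExtremal_iff_ofReal_norm_gradient_zero hα0 hαn hf
    refine ⟨fun hext => le_antisymm (BerezinBloch.blochSeminorm_le_opSeminorm hf) ?_,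
      fun hα1 => BerezinBloch.isExtremal_of_blochSeminorm_eq hα1 hαn hf, hiff⟩
    exact (hiff.2 hext).ge.trans (BerezinBloch.ofReal_norm_gradient_zero_le_blochSeminorm _)
  · refine (BerezinBloch.opSeminorm_lt hαn).trans_eq (congrArg ENNReal.ofReal ?_)
    have h1 : Ring.choose (2 * (BerezinBloch.kPrime n α : ℝ) + 2 * α - 1)
        (2 * BerezinBloch.kPrime n α) =
        Ring.multichoose (2 * α) (2 * BerezinBloch.kPrime n α) := by
      rw [Ring.multichoose_eq]; push_cast; congr 1; ring
    have h2 : Ring.choose ((BerezinBloch.kPrime n α : ℝ) + α - 1) (BerezinBloch.kPrime n α) =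
        Ring.multichoose α (BerezinBloch.kPrime n α) := by
      rw [Ring.multichoose_eq, add_comm α]
    have h3 := BerezinBloch.normConst_mul_oddMoment (n := n) hα (BerezinBloch.kPrime n α)
    rw [h1, h2, BerezinBloch.coeffRatio]
    linear_combination Ring.multichoose (2 * α) (2 * BerezinBloch.kPrime n α) *
      (Ring.multichoose α (BerezinBloch.kPrime n α))⁻¹ * h3
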